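/- **Setting.** Let $\phi:\mathbb R\to\mathbb R$ be a cumulant generating function, i.e. $\phi(\eta)=\log\int e^{\eta y}\,\rho(dy)<\infty$ for all $\eta\in\mathbb R$ for some nonzero measure $\rho$ on $\mathbb R$, with $|\phi^{(k)}|\le B_k$ for $k=2,3,4,5$. Let $p\ge 2$, and let $x_1,\dots,x_n$ be i.i.d. random vectors in $\mathbb R^p$ with $\|x_i\|_2\le\sqrt K$ a.s., $\mathbb E[x_i]=0$ and $\mathbb E[x_ix_i^T]=\Sigma$, where $\Sigma=\sigma^2I+\sum_{i=1}^r\theta_iu_iu_i^T$ with $0\le r<p$, $\sigma>0$, $\theta_i\ge0$ and $u_1,\dots,u_r$ orthonormal. The responses $y_1,\dots,y_n$ are arbitrary real random variables, and $\ell(\beta)=\frac1n\sum_{i=1}^n[\phi(\langle x_i,\beta\rangle)-y_i\langle x_i,\beta\rangle]$. Let $R>0$, let $B_p(R)$ be the closed centred ball of radius $R$, $\mathcal P$ the Euclidean projection onto it, and let $S\subset\{1,\dots,n\}$ be uniformly distributed over the subsets of size $|S|$, independently of the data. **Newton-Stein iterates (step size 1).** Let $\widehat\Sigma_S=\frac1{|S|}\sum_{i\in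 S}x_ix_i^T$, and let $\zeta=\zeta_r(\widehat\Sigma_S)$ be obtained from $\widehat\Sigma_S$ by keeping its $r$ largest eigenvalues and setting all others to the $(r+1)$-st largest one (same eigenvectors). Put $\hat\mu_k(\beta)=\frac1n\sum_i\phi^{(k)}(\langle x_i,\beta\rangle)$. From any (possibly random) $\hat\beta^0\in\mathbb R^p$ define $\hat\beta^{t+1}=\mathcal P\big(\hat\beta^t-\mathbf Q^t\nabla\ell(\hat\beta^t)\big)$, where $$\mathbf Q^t=\frac1{\hat\mu_2(\hat\beta^t)}\Big[\zeta^{-1}-\frac{\hat\mu_4(\hat\beta^t)\,\hat\beta^t[\hat\beta^t]^T}{\hat\mu_2(\hat\beta^t)+\hat\mu_4(\hat\beta^t)\langle\zeta\hat\beta^t,\hat\beta^t\rangle}\Big].$$ **Optimal value and event.** Let $\beta_*$ be a random vector with values in $B_p(R)$ a.s. which is a global minimizer of $\ell$ whenever $\ell$ has a global minimizer in $B_p(R)$. Write $\mu_k(\beta)=\mathbb E[\phi^{(k)}(\langle x,\beta\rangle)]$ for fixed $\beta$, where $x$ has the law of the $x_i$. Let $m>0$ satisfy $\mu_2(\beta)\ge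 m$ on $B_p(R)$ (such an $m$ exists whenever $\phi$ is not affine). For $\xi>0$ and $t\ge1$ let $\mathcal E$ be the event that $|\mu_2(\hat\beta^t)+\mu_4(\hat\beta^t)\langle\Sigma\hat\beta^t,\hat\beta^t\rangle|>\xi$ and that $\beta_*$ is a global minimizer of $\ell$ lying in $B_p(R)$. **Coefficients.** For $z\sim\mathsf N_p(0,\Sigma)$ and a class $\mathcal H$ of functions let $d_{\mathcal H}(x,z)=\sup_{h\in\mathcal H}|\mathbb E h(x)-\mathbb E h(z)|$, and let $$\mathfrak D(x,z)=\|\Sigma\|_2\,d_{\mathcal H_1}(x,z)+\|\Sigma\|_2^2R^2\,d_{\mathcal H_2}(x,z)+d_{\mathcal H_3}(x,z),$$ where $\mathcal H_1,\mathcal H_2,\mathcal H_3$ consist of the functions $\phi^{(2)}(\langle\cdot,\beta\rangle)$, $\phi^{(4)}(\langle\cdot,\beta\rangle)$ and $\langle v,\cdot\rangle^2\phi^{(2)}(\langle\cdot,\beta\rangle)$ respectively, with $\beta\in B_p(R)$ and $\|v\|_2=1$. For constants $c_1,c_2$ put $$\kappa=\frac2m\Big[\frac2{\sigma^2}+\frac{2B_4R^2}{\xi}\Big],\qquad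 \tau_1=\kappa\,\mathfrak D(x,z)+c_1\kappa\sqrt{\frac p{\min\{\frac p{\log p}|S|,\ \frac n{\log n}\}}},\qquad\tau_2=c_2\kappa .$$ **Claim.** There are positive constants $c,c_1,c_2$ depending only on $K,R,B_2,B_4$ such that the following holds whenever $n$ and $|S|$ exceed a threshold depending only on $K,R,B_2,\dots,B_5,m,\sigma,\xi$. If $\delta\ge\mathbb P(\mathcal E^c)$, $\epsilon\ge20R\{c/p^2+\delta\}$ and $\mathbb E\|\hat\beta^t-\beta_*\|_2>\epsilon$, then $$\mathbb E\|\hat\beta^{t+1}-\beta_*\|_2\le(\tau_1+0.1)\,\mathbb E\|\hat\beta^t-\beta_*\|_2+\tau_2\,\mathbb E\|\hat\beta^t-\beta_*\|_2^2 .$$ -/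

import Mathlib

open MeasureTheory ProbabilityTheory

namespace NewtonStein

/-- `p`-dimensional Euclidean space. -/
abbrev Vec (p : ℕ) : Type := EuclideanSpace ℝ (Fin p)

/-- Real `p × p` matrices. -/
abbrev Mat (p : ℕ) : Type := Matrix (Fin p) (Fin p) ℝ

/-- Random index sets carry the discrete sigma-algebra. -/
instance instMeasurableSpaceFinsetFin (n : ℕ) : MeasurableSpace (Finset (Fin n)) := ⊤

/-- The action of a matrix on Euclidean vectors. -/
noncomputable def act {p : ℕ} (A : Mat p) (v : Vec p) : Vec p :=
  Matrix.toEuclideanCLM (𝕜 := ℝ) A v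

/-- The spectral norm of a matrix. -/
noncomputable def specNorm {p : ℕ} (A : Mat p) : ℝ :=
  ‖Matrix.toEuclideanCLM (𝕜 := ℝ) A‖

/-- The rank-one matrix `v vᵀ`. -/
def outer {p : ℕ} (v : Vec p) : Mat p := Matrix.vecMulVec v v

/-! ### Generalized linear models -/

/-- `φ` is the cumulant generating function of an exponential family on the line: there is a
nonzero carrier measure `ρ` such that `exp (η y - φ η) ρ(dy)` is a probability measure for every
real natural parameter `η`, that is, `φ η = log ∫ exp (η y) ρ(dy)` with a finite integral. -/
def IsCumulantGeneratingFunction (φ : ℝ → ℝ) : Prop :=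
  ∃ ρ : Measure ℝ, ρ ≠ 0 ∧ (∀ η : ℝ, Integrable (fun y : ℝ => Real.exp (η * y)) ρ) ∧
    φ = cgf id ρ

/-- The normalized negative log-likelihood of the sample `(X i, Y i)`. -/
noncomputable def negLogLik {p n : ℕ} (φ : ℝ → ℝ) (X : Fin n → Vec p) (Y : Fin n → ℝ)
    (b : Vec p) : ℝ :=
  (1 / (n : ℝ)) * ∑ i, (φ (inner ℝ (X i) b) - Y i * inner ℝ (X i) b)

/-- The gradient of the negative log-likelihood. -/
noncomputable def gradNegLogLik {p n : ℕ} (φ : ℝ → ℝ) (X : Fin n → Vec p) (Y : Fin n → ℝ)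
    (b : Vec p) : Vec p :=
  (1 / (n : ℝ)) • ∑ i, (deriv φ (inner ℝ (X i) b) - Y i) • X i

/-- `b` is an optimal value: a global minimizer of the negative log-likelihood. -/
def IsOptimal {p n : ℕ} (φ : ℝ → ℝ) (X : Fin n → Vec p) (Y : Fin n → ℝ) (b : Vec p) : Prop :=
  ∀ b' : Vec p, negLogLik φ X Y b ≤ negLogLik φ X Y b'

/-! ### The Newton-Stein method -/

/-- The sub-sampled covariance estimator `|S|⁻¹ ∑_{i ∈ S} x_i x_iᵀ`. -/
noncomputable def sampleCov {p n : ℕ} (X : Fin n → Vec p) (S : Finset (Fin n)) : Mat p :=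
  (1 / (S.card : ℝ)) • ∑ i ∈ S, outer (X i)

theorem sampleCov_isHermitian {p n : ℕ} (X : Fin n → Vec p) (S : Finset (Fin n)) :
    (sampleCov X S).IsHermitian := by
  ext i j
  simp [sampleCov, outer, Matrix.sum_apply, Matrix.vecMulVec_apply, mul_comm]

/-- The `(r+1)`-st largest eigenvalue of a symmetric matrix
(`eigenvalues₀` lists the eigenvalues in decreasing order, starting at index `0`). -/
noncomputable def eigSucc {p : ℕ} (r : Fin p) {A : Mat p} (hA : A.IsHermitian) : ℝ :=
  hA.eigenvalues₀ (Fin.cast (Fintype.card_fin p).symm r)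

/-- Eigenvalue thresholding: the largest `r` eigenvalues are kept and all the others are set to the
`(r+1)`-st one, the eigenvectors being unchanged. -/
noncomputable def threshold {p : ℕ} (r : Fin p) {A : Mat p} (hA : A.IsHermitian) : Mat p :=
  hA.cfc fun a => max a (eigSucc r hA)

/-- The thresholded sub-sampled covariance estimator. -/
noncomputable def covEst {p n : ℕ} (r : Fin p) (X : Fin n → Vec p) (S : Finset (Fin n)) : Mat p :=
  threshold r (sampleCov_isHermitian X S)

/-- The sample mean of `φ^(k) (⟨x_i, b⟩)`. -/
noncomputable def muHat {p n : ℕ} (φ : ℝ → ℝ) (k : ℕ) (X : Fin n → Vec p) (b : Vec p) : ℝ :=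
  (1 / (n : ℝ)) * ∑ i, iteratedDeriv k φ (inner ℝ (X i) b)

/-- The scaling matrix. The coefficient `1 / (μ̂₂ / μ̂₄ + ⟨ζ b, b⟩)` of `b bᵀ` is written as
`μ̂₄ / (μ̂₂ + μ̂₄ ⟨ζ b, b⟩)`, which has the intended value `0` when `μ̂₄ = 0`. -/
noncomputable def scaling {p n : ℕ} (φ : ℝ → ℝ) (r : Fin p) (X : Fin n → Vec p)
    (S : Finset (Fin n)) (b : Vec p) : Mat p :=
  (1 / muHat φ 2 X b) • ((covEst r X S)⁻¹ -
    (muHat φ 4 X b /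
      (muHat φ 2 X b + muHat φ 4 X b * inner ℝ (act (covEst r X S) b) b)) • outer b)

/-- Euclidean projection onto the closed ball of radius `R` centred at the origin. -/
noncomputable def projBall {p : ℕ} (R : ℝ) (v : Vec p) : Vec p :=
  if ‖v‖ ≤ R then v else (R / ‖v‖) • v

/-- The iterates of the Newton-Stein method with step size `1`, rank threshold `r`, projection
radius `R`, sub-sample `S` and initial point `b₀`. -/
noncomputable def iterate {p n : ℕ} (φ : ℝ → ℝ) (R : ℝ) (r : Fin p) (X : Fin n → Vec p)
    (Y : Fin n → ℝ) (S : Finset (Fin n)) (b₀ : Vec p) : ℕ → Vec p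
  | 0 => b₀
  | t + 1 =>
    let b := iterate φ R r X Y S b₀ t
    projBall R (b - act (scaling φ r X S b) (gradNegLogLik φ X Y b))

/-! ### Distributional quantities -/

/-- `Sg` is the second moment matrix `E[x xᵀ]` of a random vector `x` with law `law`. -/
def HasSecondMoment {p : ℕ} (law : Measure (Vec p)) (Sg : Mat p) : Prop :=
  ∀ i j, ∫ v, v i * v j ∂law = Sg i j

/-- The spiked model with `r` spikes and noise level `σ²`:
`Σ = σ² I + ∑_{i ≤ r} θ_i u_i u_iᵀ` with `θ_i ≥ 0` and orthonormal `u_i`. -/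
def IsSpiked {p : ℕ} (r : ℕ) (σ : ℝ) (Sg : Mat p) : Prop :=
  ∃ (θ : Fin r → ℝ) (u : Fin r → Vec p), (∀ i, 0 ≤ θ i) ∧ Orthonormal ℝ u ∧
    Sg = σ ^ 2 • (1 : Mat p) + ∑ i, θ i • outer (u i)

/-- `μ_k(b) = E[φ^(k) (⟨x, b⟩)]` for `x` with law `law`. -/
noncomputable def mu {p : ℕ} (φ : ℝ → ℝ) (k : ℕ) (law : Measure (Vec p)) (b : Vec p) : ℝ :=
  ∫ v, iteratedDeriv k φ (inner ℝ v b) ∂law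

/-- The probability metric `sup_{h ∈ H} |E h(x) - E h(z)|` of a class `H` of functions. -/
noncomputable def probMetric {p : ℕ} (H : Set (Vec p → ℝ)) (law law' : Measure (Vec p)) : ℝ :=
  sSup ((fun h : Vec p → ℝ => |(∫ v, h v ∂law) - ∫ v, h v ∂law'|) '' H)

/-- The functions `x ↦ φ^(k) (⟨x, b⟩)` with `b` in the ball of radius `R`
(`k = 2` and `k = 4` give the first two classes). -/
def derivClass (p : ℕ) (φ : ℝ → ℝ) (k : ℕ) (R : ℝ) : Set (Vec p → ℝ) :=
  {h | ∃ b : Vec p, ‖b‖ ≤ R ∧ h = fun x => iteratedDeriv k φ (inner ℝ x b)}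

/-- The functions `x ↦ ⟨v, x⟩² φ^(2) (⟨x, b⟩)` with `b` in the ball of radius `R` and `v` a unit
vector. -/
def hessClass (p : ℕ) (φ : ℝ → ℝ) (R : ℝ) : Set (Vec p → ℝ) :=
  {h | ∃ b v : Vec p, ‖b‖ ≤ R ∧ ‖v‖ = 1 ∧
    h = fun x => (inner ℝ v x) ^ 2 * iteratedDeriv 2 φ (inner ℝ x b)}

/-- The distance `𝔇(x, z)` between the law of `x`, with covariance `Sg`, and the Gaussian law with
mean zero and the same covariance. -/
noncomputable def gaussDist {p : ℕ} (φ : ℝ → ℝ) (R : ℝ) (law : Measure (Vec p)) (Sg : Mat p) : ℝ :=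
  specNorm Sg * probMetric (derivClass p φ 2 R) law (multivariateGaussian 0 Sg) +
    specNorm Sg ^ 2 * R ^ 2 * probMetric (derivClass p φ 4 R) law (multivariateGaussian 0 Sg) +
    probMetric (hessClass p φ R) law (multivariateGaussian 0 Sg)

/-- The constant `κ`, in terms of a lower bound `m` of `μ₂` on the ball of radius `R`, the noise level
`σ²` of the covariance, the constant `ξ` of the event and a bound `B₄` of `|φ^(4)|`. -/
noncomputable def kappa (m σ ξ B₄ R : ℝ) : ℝ :=
  2 / m * (2 / σ ^ 2 + 2 * B₄ * R ^ 2 / ξ)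

/-- The coefficient `τ₁` of the linear term. -/
noncomputable def tau₁ (κ c₁ D : ℝ) (p n s : ℕ) : ℝ :=
  κ * D + c₁ * κ *
    Real.sqrt ((p : ℝ) / min ((p : ℝ) / Real.log p * s) ((n : ℝ) / Real.log n))

/-- The coefficient `τ₂` of the quadratic term. -/
def tau₂ (κ c₂ : ℝ) : ℝ := c₂ * κ

/-- The event that the current iterate `b` satisfies `|μ₂(b) + μ₄(b) ⟨Σ b, b⟩| > ξ` and that `bs` is
an optimal value lying in the ball of radius `R`. -/
def goodEvent {Ω : Type*} {p n : ℕ} (φ : ℝ → ℝ) (R ξ : ℝ) (law : Measure (Vec p)) (Sg : Mat p)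
    (X : Fin n → Ω → Vec p) (Y : Fin n → Ω → ℝ) (b bs : Ω → Vec p) : Set Ω :=
  {ω | ξ < |mu φ 2 law (b ω) + mu φ 4 law (b ω) * inner ℝ (act Sg (b ω)) (b ω)| ∧
    IsOptimal φ (fun i => X i ω) (fun i => Y i ω) (bs ω) ∧ ‖bs ω‖ ≤ R}

end NewtonStein

/-!
The error of one Newton-Stein step is controlled by how well the scaling matrix `Q` inverts the
Hessian of the negative log-likelihood.

*Deterministic part.* By the Sherman-Morrison formula (`act_scaling_stein`), `Q` is the exact inverse
of `A = μ̂₂ ζ + μ̂₄ (ζ b)(ζ b)ᵀ`. The gradient vanishes at a global minimizer `b*`, and at `b` it is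
`H (b - b*)` up to a quadratic remainder, `H` being the sample Hessian at `b`
(`norm_gradNegLogLik_sub_le`); the projection does not increase distances to points of the ball.
Hence the new error is at most `‖Q‖ ‖A - H‖ ‖b - b*‖` plus a quadratic term (`norm_step_sub_le`). The
constant of the quadratic term must not involve the bound `B₃` on the third derivative of `φ`;
Landau's interpolation between the second and the fourth derivative (`abs_deriv_le_of_abs_le`)
provides a bound in terms of `B₂` and `B₄`.

*Population part.* For Gaussian covariates Stein's identity
(`integral_sq_mul_multivariateGaussian`) says that the population version of `A` is exactly the
population Hessian. Replacing the Gaussian law by the law of the covariates in the three expectations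
involved costs at most `𝔇(x, z)` (`abs_stein_hessian_sub_le`), whence the term `κ 𝔇`.

*Concentration.* The empirical quantities are uniformly close to the population ones on typical
samples (`IsTypicalSample`), and thresholding is stable at a spiked covariance
(`IsSpiked.threshold_near`). Since `σ² I ≤ Σ` and `tr Σ = E‖x‖² ≤ K`, the dimension is at most `K / σ²`
(`HasSecondMoment.card_mul_sq_le`). The threshold for `n` and `|S|` may depend on `K` and `σ`, hence on
all dimensions that occur, so a weak uniform law of large numbers (Chebyshev's inequality on a finite
net, `exists_uniform_sampleAverage`) already makes the concentration error and the probability of an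
atypical sample smaller than a fixed multiple of `p⁻²`. Of the square-root term of `τ₁` only the
nonnegativity is then needed.

*Expectation.* Off the good event the error is at most `2R`. The assumption that the current mean error
exceeds `20 R (c / p² + δ)` lets the term `0.1 E‖b - b*‖` absorb both this and the concentration error.
-/

namespace NewtonStein

/-! ### Stein's identity for Gaussian laws -/

theorem hasDerivAt_gaussianPDFReal_zero {v : NNReal} (hv : v ≠ 0) (x : ℝ) :
    HasDerivAt (gaussianPDFReal 0 v) (-(x / v) * gaussianPDFReal 0 v x) x := by
  have hv' : (v : ℝ) ≠ 0 := by exact_mod_cast hv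
  have h : HasDerivAt (fun y : ℝ => -(y - 0) ^ 2 / (2 * v)) (-(x / v)) x := by
    have := (((hasDerivAt_id x).sub_const 0).pow 2).neg.div_const (2 * (v : ℝ))
    refine this.congr_deriv ?_
    simp
    field_simp
  refine ((h.exp.const_mul (Real.sqrt (2 * Real.pi * v))⁻¹)).congr_deriv ?_
  simp only [gaussianPDFReal]
  ring

theorem integrable_gaussianPDFReal_mul {v : NNReal} (hv : v ≠ 0) {f : ℝ → ℝ}
    (hf : Integrable f (gaussianReal 0 v)) :
    Integrable fun x => gaussianPDFReal 0 v x * f x := by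
  rw [gaussianReal_of_var_ne_zero _ hv, integrable_withDensity_iff_integrable_smul'
    (measurable_gaussianPDF _ _) (ae_of_all _ fun _ => gaussianPDF_lt_top)] at hf
  simpa [toReal_gaussianPDF] using hf

/-- Stein's identity on the line, by integration by parts against the Gaussian density. -/
theorem integral_mul_gaussianReal (v : NNReal) {f f' : ℝ → ℝ} (hd : ∀ x, HasDerivAt f (f' x) x)
    (hf : Integrable f (gaussianReal 0 v)) (hxf : Integrable (fun x => x * f x) (gaussianReal 0 v))
    (hf' : Integrable f' (gaussianReal 0 v)) :
    ∫ x, x * f x ∂gaussianReal 0 v = v * ∫ x, f' x ∂gaussianReal 0 v := by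
  by_cases hv : v = 0
  · simp [hv, gaussianReal_zero_var]
  have hv' : (v : ℝ) ≠ 0 := by exact_mod_cast hv
  rw [integral_gaussianReal_eq_integral_smul hv, integral_gaussianReal_eq_integral_smul hv]
  have h := integral_mul_deriv_eq_deriv_mul_of_integrable
    (u := gaussianPDFReal 0 v) (u' := fun x => -(x / v) * gaussianPDFReal 0 v x) (v := f) (v' := f')
    (fun x _ => hasDerivAt_gaussianPDFReal_zero hv x) (fun x _ => hd x)
    (integrable_gaussianPDFReal_mul hv hf')
    (((integrable_gaussianPDFReal_mul hv hxf).const_mul (-(v : ℝ)⁻¹)).congr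
      (ae_of_all _ fun x => by simp [div_eq_mul_inv]; ring))
    (integrable_gaussianPDFReal_mul hv hf)
  simp only [smul_eq_mul]
  rw [h, ← integral_neg, ← integral_const_mul]
  congr 1
  ext x
  field_simp

theorem integrable_pow_gaussianReal (v : NNReal) (k : ℕ) :
    Integrable (fun x : ℝ => x ^ k) (gaussianReal 0 v) := by
  have h := (memLp_id_gaussianReal (μ := 0) (v := v) k).integrable_norm_pow'
  refine (h.mono' (by fun_prop) (ae_of_all _ fun x => ?_))
  simp

/-- The second-order form of Stein's identity on the line. -/
theorem integral_sq_mul_gaussianReal (v : NNReal) {f f' f'' : ℝ → ℝ}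
    (hd : ∀ x, HasDerivAt f (f' x) x) (hd' : ∀ x, HasDerivAt f' (f'' x) x)
    (hc : Continuous f'') {B B' B'' : ℝ}
    (hB : ∀ x, |f x| ≤ B) (hB' : ∀ x, |f' x| ≤ B') (hB'' : ∀ x, |f'' x| ≤ B'') :
    ∫ x, x ^ 2 * f x ∂gaussianReal 0 v
      = v * ∫ x, f x ∂gaussianReal 0 v + v ^ 2 * ∫ x, f'' x ∂gaussianReal 0 v := by
  have hcf : Continuous f := continuous_iff_continuousAt.2 fun x => (hd x).continuousAt
  have hcf' : Continuous f' := continuous_iff_continuousAt.2 fun x => (hd' x).continuousAt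
  have key : ∀ (g : ℝ → ℝ) (C : ℝ) (k : ℕ), Continuous g → (∀ x, |g x| ≤ C) →
      Integrable (fun x => x ^ k * g x) (gaussianReal 0 v) := fun g C k hg hC =>
    (integrable_pow_gaussianReal v k).mul_bdd (c := C) hg.aestronglyMeasurable
      (ae_of_all _ hC)
  have i0 : ∀ (g : ℝ → ℝ) (C : ℝ), Continuous g → (∀ x, |g x| ≤ C) →
      Integrable g (gaussianReal 0 v) := fun g C hg hC => by simpa using key g C 0 hg hC
  have i1 : ∀ (g : ℝ → ℝ) (C : ℝ), Continuous g → (∀ x, |g x| ≤ C) →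
      Integrable (fun x => x * g x) (gaussianReal 0 v) := fun g C hg hC => by
    simpa using key g C 1 hg hC
  have h1 := integral_mul_gaussianReal v (f := fun x => x * f x) (f' := fun x => f x + x * f' x)
    (fun x => ((hasDerivAt_id' x).mul (hd x)).congr_deriv (by rw [one_mul])) (i1 f B hcf hB)
    ((key f B 2 hcf hB).congr (ae_of_all _ fun x => by ring))
    ((i0 f B hcf hB).add (i1 f' B' hcf' hB'))
  have h2 := integral_mul_gaussianReal v hd' (i0 f' B' hcf' hB') (i1 f' B' hcf' hB')
    (i0 f'' B'' hc hB'')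
  rw [integral_add (i0 f B hcf hB) (i1 f' B' hcf' hB'), h2] at h1
  have : (fun x => x ^ 2 * f x) = fun x => x * (x * f x) := by ext; ring
  rw [this, h1]
  ring

/-- Stein's identity for a centred Gaussian pair `(W, V)`: regress `V` on `W`, the remainder being
independent of `W`, and apply the identity on the line to `W`. -/
theorem integral_sq_mul_comp_of_hasGaussianLaw {Ω : Type*} [MeasurableSpace Ω] {P : Measure Ω}
    {W V : Ω → ℝ} (hWV : HasGaussianLaw (fun ω => (W ω, V ω)) P) (hW0 : P[W] = 0) (hV0 : P[V] = 0)
    {f f' f'' : ℝ → ℝ}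
    (hd : ∀ x, HasDerivAt f (f' x) x) (hd' : ∀ x, HasDerivAt f' (f'' x) x)
    (hc : Continuous f'') {B B' B'' : ℝ}
    (hB : ∀ x, |f x| ≤ B) (hB' : ∀ x, |f' x| ≤ B') (hB'' : ∀ x, |f'' x| ≤ B'') :
    ∫ ω, V ω ^ 2 * f (W ω) ∂P
      = Var[V; P] * ∫ ω, f (W ω) ∂P + cov[W, V; P] ^ 2 * ∫ ω, f'' (W ω) ∂P := by
  have hP := hWV.isProbabilityMeasure
  have hcf : Continuous f := continuous_iff_continuousAt.2 fun x => (hd x).continuousAt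
  have hW := hWV.fst
  have hV := hWV.snd
  have hWm := hW.aemeasurable
  have hVm := hV.aemeasurable
  have hW2 := hW.memLp_two
  have hV2 := hV.memLp_two
  set s := Var[W; P] with hs
  set q := cov[W, V; P] with hq
  have hs0 : 0 ≤ s := variance_nonneg _ _
  obtain ⟨a, ha⟩ : ∃ a, a * s = q := by
    by_cases h0 : s = 0
    · refine ⟨0, ?_⟩
      have hae := ae_eq_integral_of_variance_eq_zero hW2 h0
      have : q = 0 := by
        rw [hq, covariance]
        refine integral_eq_zero_of_ae ?_
        filter_upwards [hae] with ω hω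
        simp [hω]
      simp [this]
    · exact ⟨q / s, div_mul_cancel₀ _ h0⟩
  -- the remainder of the regression of `V` on `W`
  set U : Ω → ℝ := fun ω => V ω - a * W ω with hU
  have hWU : HasGaussianLaw (fun ω => (W ω, U ω)) P := by
    have := hWV.map_fun ((ContinuousLinearMap.fst ℝ ℝ ℝ).prod
      (ContinuousLinearMap.snd ℝ ℝ ℝ - a • ContinuousLinearMap.fst ℝ ℝ ℝ))
    simpa [hU] using this
  have hU2 : MemLp U 2 P := hWU.snd.memLp_two
  have haW2 : MemLp (fun ω => a * W ω) 2 P := hW2.const_mul a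
  have hcov : cov[W, U; P] = 0 := by
    rw [hU, covariance_fun_sub_right hW2 hV2 haW2, covariance_const_mul_right, covariance_self hWm,
      ← hs, ha, hq, sub_self]
  have hind : IndepFun W U P := hWU.indepFun_of_covariance_eq_zero hcov
  have hWi := hW.integrable
  have hVi := hV.integrable
  have hU0 : P[U] = 0 := by
    have : P[U] = P[V] - a * P[W] := by
      rw [hU]
      rw [integral_sub hVi (hWi.const_mul a), integral_const_mul]
    rw [this, hW0, hV0]; simp
  have hfW : AEStronglyMeasurable (fun ω => f (W ω)) P :=
    (hcf.measurable.comp_aemeasurable hWm).aestronglyMeasurable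
  have hfWi : Integrable (fun ω => f (W ω)) P :=
    Integrable.of_bound hfW B (ae_of_all _ fun ω => hB _)
  have bd : ∀ g : Ω → ℝ, Integrable g P → Integrable (fun ω => g ω * f (W ω)) P := fun g hg =>
    hg.mul_bdd (c := B) hfW (ae_of_all _ fun ω => hB _)
  have e1 : ∫ ω, W ω ^ 2 * f (W ω) ∂P = s * ∫ ω, f (W ω) ∂P + s ^ 2 * ∫ ω, f'' (W ω) ∂P := by
    have hlaw := hW.map_eq_gaussianReal
    rw [hW0, ← hs] at hlaw
    have h := integral_sq_mul_gaussianReal s.toNNReal hd hd' hc hB hB' hB''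
    rw [← hlaw, integral_map hWm (by fun_prop), integral_map hWm (by fun_prop),
      integral_map hWm (by fun_prop), Real.coe_toNNReal _ hs0] at h
    exact h
  have e2 : ∫ ω, U ω * (W ω * f (W ω)) ∂P = 0 := by
    have hi : IndepFun U (fun ω => W ω * f (W ω)) P :=
      hind.symm.comp (φ := id) (ψ := fun x => x * f x) measurable_id
        (by fun_prop)
    rw [hi.integral_fun_mul_eq_mul_integral hU2.1 (hWm.aestronglyMeasurable.mul hfW), hU0]
    simp
  have e3 : ∫ ω, U ω ^ 2 * f (W ω) ∂P = Var[U; P] * ∫ ω, f (W ω) ∂P := by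
    have hi : IndepFun (fun ω => U ω ^ 2) (fun ω => f (W ω)) P :=
      hind.symm.comp (φ := fun x => x ^ 2) (ψ := f) (by fun_prop) hcf.measurable
    rw [hi.integral_fun_mul_eq_mul_integral hU2.integrable_sq.1 hfW,
      variance_of_integral_eq_zero hU2.1.aemeasurable hU0]
  have eV : Var[V; P] = a ^ 2 * s + Var[U; P] := by
    have hVeq : V = (fun ω => a * W ω) + U := by ext ω; simp [hU]
    rw [hVeq, variance_add haW2 hU2, covariance_const_mul_left, hcov, variance_const_mul]
    simp [hs]
  have hint1 := (bd _ hW2.integrable_sq).const_mul (a ^ 2)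
  have hint2 : Integrable (fun ω => U ω * (W ω * f (W ω))) P := by
    refine (bd (fun ω => U ω * W ω) (hU2.integrable_mul hW2)).congr (ae_of_all _ fun ω => ?_)
    simp only; ring
  have hint3 := bd _ hU2.integrable_sq
  have : ∫ ω, V ω ^ 2 * f (W ω) ∂P = a ^ 2 * (∫ ω, W ω ^ 2 * f (W ω) ∂P)
      + 2 * a * (∫ ω, U ω * (W ω * f (W ω)) ∂P) + ∫ ω, U ω ^ 2 * f (W ω) ∂P := by
    have hint2' := hint2.const_mul (2 * a)
    have hint12 : Integrable (fun ω => a ^ 2 * (W ω ^ 2 * f (W ω)) +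
        2 * a * (U ω * (W ω * f (W ω)))) P := hint1.add hint2'
    rw [← integral_const_mul, ← integral_const_mul, ← integral_add hint1 hint2',
      ← integral_add hint12 hint3]
    congr 1
    ext ω
    simp only [hU]
    ring
  rw [this, e1, e2, e3, eV, ← ha]
  ring

theorem inner_act {p : ℕ} (A : Mat p) (v w : Vec p) :
    inner ℝ (act A v) w = ∑ i, ∑ j, A i j * v j * w i := by
  simp only [act, PiLp.inner_apply, Matrix.ofLp_toEuclideanCLM, Matrix.mulVec, dotProduct]
  refine Finset.sum_congr rfl fun i _ => ?_
  simp only [RCLike.inner_apply, conj_trivial, Finset.mul_sum]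
  exact Finset.sum_congr rfl fun j _ => mul_comm _ _

/-- Stein's identity for the Hessian weights: for `z` Gaussian with mean zero and covariance `S`,
`E[f(⟨z, b⟩) z zᵀ] = E[f(⟨z, b⟩)] S + E[f''(⟨z, b⟩)] (S b) (S b)ᵀ`, as quadratic forms. -/
theorem integral_sq_mul_multivariateGaussian {p : ℕ} {S : Mat p} (hS : S.PosSemidef)
    (b v : Vec p) {f f' f'' : ℝ → ℝ}
    (hd : ∀ x, HasDerivAt f (f' x) x) (hd' : ∀ x, HasDerivAt f' (f'' x) x)
    (hc : Continuous f'') {B B' B'' : ℝ}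
    (hB : ∀ x, |f x| ≤ B) (hB' : ∀ x, |f' x| ≤ B') (hB'' : ∀ x, |f'' x| ≤ B'') :
    ∫ z, inner ℝ v z ^ 2 * f (inner ℝ z b) ∂multivariateGaussian 0 S
      = inner ℝ (act S v) v * ∫ z, f (inner ℝ z b) ∂multivariateGaussian 0 S +
        inner ℝ (act S b) v ^ 2 * ∫ z, f'' (inner ℝ z b) ∂multivariateGaussian 0 S := by
  set G := multivariateGaussian 0 S
  have hid : MemLp id 2 G := IsGaussian.memLp_two_id
  have hcov : ∀ x y : Vec p, cov[fun z => inner ℝ x z, fun z => inner ℝ y z; G]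
      = inner ℝ (act S x) y := fun x y => by
    rw [← covarianceBilin_apply_eq_cov hid, covarianceBilin_comm,
      covarianceBilin_multivariateGaussian hS, inner_act]
    simp only [dotProduct, Matrix.mulVec, Finset.mul_sum]
    refine Finset.sum_congr rfl fun i _ => Finset.sum_congr rfl fun j _ => by ring
  have h0 : ∀ x : Vec p, ∫ z, inner ℝ x z ∂G = 0 := fun x => by
    have := integral_inner (𝕜 := ℝ) (IsGaussian.integrable_id (μ := G)) x
    simpa [G] using this
  have hpair : HasGaussianLaw (fun z : Vec p => (inner ℝ b z, inner ℝ v z)) G :=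
    (IsGaussian.hasGaussianLaw_id (μ := G)).map_fun ((innerSL ℝ b).prod (innerSL ℝ v))
  have h := integral_sq_mul_comp_of_hasGaussianLaw hpair (h0 b) (h0 v) hd hd' hc hB hB' hB''
  rw [← covariance_self (hpair.snd.aemeasurable), hcov, hcov] at h
  simpa only [real_inner_comm b] using h

/-! ### Cumulant generating functions and the likelihood -/

theorem IsCumulantGeneratingFunction.contDiff {φ : ℝ → ℝ} (h : IsCumulantGeneratingFunction φ)
    (k : ℕ) : ContDiff ℝ k φ := by
  obtain ⟨ρ, -, hi, rfl⟩ := h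
  have hset : integrableExpSet id ρ = Set.univ := Set.eq_univ_of_forall fun η => hi η
  refine contDiff_iff_contDiffAt.2 fun x => (analyticAt_cgf ?_).contDiffAt
  simp [hset]

theorem hasDerivAt_iteratedDeriv {φ : ℝ → ℝ} (h : ∀ k : ℕ, ContDiff ℝ k φ) (k : ℕ) (x : ℝ) :
    HasDerivAt (iteratedDeriv k φ) (iteratedDeriv (k + 1) φ x) x := by
  have hd : Differentiable ℝ (iteratedDeriv k φ) :=
    (h (k + 1)).differentiable_iteratedDeriv k (by exact_mod_cast Nat.lt_succ_self k)
  rw [iteratedDeriv_succ]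
  exact (hd x).hasDerivAt

theorem abs_sub_le_of_abs_deriv_le {f f' : ℝ → ℝ} (hd : ∀ x, HasDerivAt f (f' x) x) {B : ℝ}
    (hB : ∀ x, |f' x| ≤ B) (x y : ℝ) : |f y - f x| ≤ B * |y - x| := by
  simpa using convex_univ.norm_image_sub_le_of_norm_hasDerivWithin_le (f := f)
    (fun z _ => (hd z).hasDerivWithinAt) (fun z _ => hB z) (Set.mem_univ x) (Set.mem_univ y)

/-- First-order Taylor estimate for a function with bounded second derivative. -/
theorem abs_sub_sub_mul_le {f f' f'' : ℝ → ℝ} (hd : ∀ x, HasDerivAt f (f' x) x)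
    (hd' : ∀ x, HasDerivAt f' (f'' x) x) {B : ℝ} (hB : ∀ x, |f'' x| ≤ B) (x y : ℝ) :
    |f y - f x - f' x * (y - x)| ≤ B * (y - x) ^ 2 := by
  have hB0 : 0 ≤ B := (abs_nonneg _).trans (hB 0)
  have hg : ∀ z ∈ Set.uIcc x y, HasDerivWithinAt (fun z => f z - f' x * z) (f' z - f' x)
      (Set.uIcc x y) z := fun z _ => by
    have := (hd z).sub ((hasDerivAt_id' z).const_mul (f' x))
    rw [mul_one] at this
    exact this.hasDerivWithinAt
  have hbd : ∀ z ∈ Set.uIcc x y, ‖f' z - f' x‖ ≤ B * |y - x| := fun z hz => by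
    refine (abs_sub_le_of_abs_deriv_le hd' hB x z).trans ?_
    exact mul_le_mul_of_nonneg_left (Set.abs_sub_left_of_mem_uIcc hz) hB0
  have h := (convex_uIcc x y).norm_image_sub_le_of_norm_hasDerivWithin_le hg hbd
    Set.left_mem_uIcc Set.right_mem_uIcc
  rw [Real.norm_eq_abs, Real.norm_eq_abs, mul_assoc, ← sq, sq_abs] at h
  refine le_of_eq_of_le ?_ h
  congr 1
  ring

/-- Landau's interpolation: bounds on a function and on its second derivative bound the first
derivative. -/
theorem abs_deriv_le_of_abs_le {f f' f'' : ℝ → ℝ} (hd : ∀ x, HasDerivAt f (f' x) x)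
    (hd' : ∀ x, HasDerivAt f' (f'' x) x) {A B : ℝ} (hA : ∀ x, |f x| ≤ A) (hB : ∀ x, |f'' x| ≤ B)
    (x : ℝ) : |f' x| ≤ 2 * A + B := by
  have h := abs_sub_sub_mul_le hd hd' hB x (x + 1)
  have h1 := hA x
  have h2 := hA (x + 1)
  simp only [add_sub_cancel_left, mul_one, one_pow] at h
  rw [abs_le] at *
  constructor <;> linarith [h.1, h.2, h1.1, h1.2, h2.1, h2.2]

/-- The gradient vanishes at a global minimizer of the negative log-likelihood. -/
theorem IsOptimal.gradNegLogLik_eq_zero {p n : ℕ} {φ : ℝ → ℝ} (hφ : Differentiable ℝ φ)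
    {X : Fin n → Vec p} {Y : Fin n → ℝ} {b : Vec p} (h : IsOptimal φ X Y b) :
    gradNegLogLik φ X Y b = 0 := by
  -- Fermat's rule along the line through `b` in the direction of the gradient
  set g := gradNegLogLik φ X Y b with hg
  have hder : HasDerivAt (fun t : ℝ => negLogLik φ X Y (b + t • g)) (inner ℝ g g) 0 := by
    have hin : ∀ i, HasDerivAt (fun t : ℝ => inner ℝ (X i) (b + t • g)) (inner ℝ (X i) g) 0 :=
      fun i => by
        have h1 : HasDerivAt (fun t : ℝ => inner ℝ (X i) b + t * inner ℝ (X i) g)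
            (inner ℝ (X i) g) 0 := by
          simpa using ((hasDerivAt_id' (0 : ℝ)).mul_const (inner ℝ (X i) g)).const_add
            (inner ℝ (X i) b)
        simpa only [inner_add_right, inner_smul_right] using h1
    have hterm : ∀ i ∈ Finset.univ, HasDerivAt (fun t : ℝ => φ (inner ℝ (X i) (b + t • g)) -
        Y i * inner ℝ (X i) (b + t • g))
        ((deriv φ (inner ℝ (X i) b) - Y i) * inner ℝ (X i) g) 0 := fun i _ => by
      have h2 : HasDerivAt φ (deriv φ (inner ℝ (X i) b)) (inner ℝ (X i) (b + (0 : ℝ) • g)) := by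
        rw [zero_smul, add_zero]
        exact (hφ _).hasDerivAt
      have := (h2.comp (0 : ℝ) (hin i)).sub ((hin i).const_mul (Y i))
      exact this.congr_deriv (by ring)
    have := (HasDerivAt.fun_sum hterm).const_mul (1 / (n : ℝ))
    refine this.congr_deriv ?_
    have e : ∀ w, inner ℝ g w
        = 1 / (n : ℝ) * ∑ i, (deriv φ (inner ℝ (X i) b) - Y i) * inner ℝ (X i) w := fun w => by
      rw [hg, gradNegLogLik, inner_smul_left, sum_inner]
      simp [inner_smul_left]
    exact (e g).symm
  have hmin : IsLocalMin (fun t : ℝ => negLogLik φ X Y (b + t • g)) 0 :=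
    Filter.Eventually.of_forall fun t => by simpa using h (b + t • g)
  exact inner_self_eq_zero.1 (hmin.hasDerivAt_eq_zero hder)

/-! ### Spectral thresholding of a perturbed spiked matrix -/

theorem act_add_right {p : ℕ} (A : Mat p) (v w : Vec p) : act A (v + w) = act A v + act A w :=
  map_add _ _ _

theorem act_smul_right {p : ℕ} (A : Mat p) (c : ℝ) (v : Vec p) : act A (c • v) = c • act A v :=
  map_smul _ _ _

theorem act_mul {p : ℕ} (A B : Mat p) (v : Vec p) : act (A * B) v = act A (act B v) := by
  simp [act]

theorem act_one {p : ℕ} (v : Vec p) : act (1 : Mat p) v = v := by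
  simp [act]

theorem act_add {p : ℕ} (A B : Mat p) (v : Vec p) : act (A + B) v = act A v + act B v := by
  simp [act]

theorem act_sub {p : ℕ} (A B : Mat p) (v : Vec p) : act (A - B) v = act A v - act B v := by
  simp [act]

theorem act_smul {p : ℕ} (c : ℝ) (A : Mat p) (v : Vec p) : act (c • A) v = c • act A v := by
  simp [act]

theorem act_sum {p : ℕ} {ι : Type*} (s : Finset ι) (A : ι → Mat p) (v : Vec p) :
    act (∑ i ∈ s, A i) v = ∑ i ∈ s, act (A i) v := by
  simp [act]

theorem act_outer {p : ℕ} (u v : Vec p) : act (outer u) v = inner ℝ u v • u := by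
  ext i
  simp only [act, outer, Matrix.ofLp_toEuclideanCLM, Matrix.mulVec, dotProduct,
    Matrix.vecMulVec_apply, PiLp.smul_apply, PiLp.inner_apply, smul_eq_mul, Finset.sum_mul,
    RCLike.inner_apply, conj_trivial]
  exact Finset.sum_congr rfl fun j _ => by ring

theorem norm_act_le {p : ℕ} (A : Mat p) (v : Vec p) : ‖act A v‖ ≤ specNorm A * ‖v‖ :=
  ContinuousLinearMap.le_opNorm _ _

theorem specNorm_nonneg {p : ℕ} (A : Mat p) : 0 ≤ specNorm A := norm_nonneg _

theorem inner_act_comm {p : ℕ} {A : Mat p} (hA : A.IsHermitian) (v w : Vec p) :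
    inner ℝ (act A v) w = inner ℝ (act A w) v := by
  rw [inner_act, inner_act, Finset.sum_comm]
  refine Finset.sum_congr rfl fun i _ => Finset.sum_congr rfl fun j _ => ?_
  have := hA.apply i j
  simp only [star_trivial] at this
  rw [this]
  ring

theorem act_cfc_eigenvectorBasis {p : ℕ} {A : Mat p} (hA : A.IsHermitian) (f : ℝ → ℝ) (j : Fin p) :
    act (hA.cfc f) (hA.eigenvectorBasis j) = f (hA.eigenvalues j) • hA.eigenvectorBasis j := by
  refine PiLp.ext fun i => congrFun (?_ : _ = _) i
  rw [act, Matrix.ofLp_toEuclideanCLM, Matrix.IsHermitian.cfc, Unitary.conjStarAlgAut_apply,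
    ← Matrix.mulVec_mulVec, ← Matrix.mulVec_mulVec, hA.star_eigenvectorUnitary_mulVec,
    Matrix.diagonal_mulVec_single]
  have : (Pi.single j ((RCLike.ofReal ∘ f ∘ hA.eigenvalues) j * 1) : Fin p → ℝ)
      = f (hA.eigenvalues j) • Pi.single j 1 := by
    rw [← Pi.single_smul]
    simp
  rw [this, Matrix.mulVec_smul, hA.eigenvectorUnitary_mulVec]
  rfl

theorem act_eigenvectorBasis {p : ℕ} {A : Mat p} (hA : A.IsHermitian) (j : Fin p) :
    act A (hA.eigenvectorBasis j) = hA.eigenvalues j • hA.eigenvectorBasis j := by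
  refine PiLp.ext fun i => congrFun (?_ : _ = _) i
  rw [act, Matrix.ofLp_toEuclideanCLM, hA.mulVec_eigenvectorBasis]
  rfl

theorem inner_act_of_orthonormalBasis {p : ℕ} {A : Mat p} (e : OrthonormalBasis (Fin p) ℝ (Vec p))
    (l : Fin p → ℝ) (h : ∀ j, act A (e j) = l j • e j) (v w : Vec p) :
    inner ℝ (act A v) w = ∑ j, l j * (inner ℝ (e j) v * inner ℝ (e j) w) := by
  have : act A v = ∑ j, (l j * inner ℝ (e j) v) • e j := by
    conv_lhs => rw [← e.sum_repr' v]
    simp only [act, map_sum, map_smul]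
    refine Finset.sum_congr rfl fun j _ => ?_
    have := h j
    rw [act] at this
    rw [this, smul_smul, mul_comm]
  rw [this, sum_inner]
  refine Finset.sum_congr rfl fun j _ => ?_
  rw [inner_smul_left]
  simp [mul_assoc]

theorem norm_sq_eq_sum_of_orthonormalBasis {p : ℕ} (e : OrthonormalBasis (Fin p) ℝ (Vec p))
    (v : Vec p) : ‖v‖ ^ 2 = ∑ j, inner ℝ (e j) v ^ 2 := by
  rw [← e.sum_sq_norm_inner_right v]
  simp

theorem isHermitian_of_inner_act_comm {p : ℕ} {A : Mat p}
    (h : ∀ v w : Vec p, inner ℝ (act A v) w = inner ℝ (act A w) v) : A.IsHermitian := by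
  ext i j
  have := h (EuclideanSpace.single i 1) (EuclideanSpace.single j 1)
  simpa [act, PiLp.inner_apply, PiLp.single_apply] using this

/-- Half of the Courant-Fischer principle: if the quadratic form of `A` is at most `c` on the
orthogonal complement of `r` vectors, the `(r+1)`-st largest eigenvalue is at most `c`. A nonzero
combination of the first `r + 1` eigenvectors meets that complement. -/
theorem eigSucc_le {p : ℕ} {r : Fin p} {A : Mat p} (hA : A.IsHermitian) (u : Fin (r : ℕ) → Vec p)
    {c : ℝ} (hc : ∀ v : Vec p, (∀ i, inner ℝ (u i) v = 0) → inner ℝ (act A v) v ≤ c * ‖v‖ ^ 2) :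
    eigSucc r hA ≤ c := by
  set e := hA.eigenvectorBasis
  set κ : Fin ((r : ℕ) + 1) → Fin p := fun k =>
    Fintype.equivOfCardEq (Fintype.card_fin _)
      (Fin.cast (Fintype.card_fin p).symm (Fin.castLE r.isLt k)) with hκ
  have hκi : Function.Injective κ := fun a b hab => by
    have := (Fintype.equivOfCardEq (Fintype.card_fin _)).injective hab
    simpa [Fin.ext_iff] using this
  have hval : ∀ k, eigSucc r hA ≤ hA.eigenvalues (κ k) := fun k => by
    simp only [eigSucc, Matrix.IsHermitian.eigenvalues, hκ, Equiv.symm_apply_apply]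
    refine hA.eigenvalues₀_antitone ?_
    rw [Fin.le_def]
    simpa using Nat.lt_succ_iff.1 k.isLt
  let comb : (Fin ((r : ℕ) + 1) → ℝ) →ₗ[ℝ] Vec p :=
    Fintype.linearCombination ℝ fun k => e (κ k)
  let F : (Fin ((r : ℕ) + 1) → ℝ) →ₗ[ℝ] (Fin (r : ℕ) → ℝ) :=
    LinearMap.pi fun i => (innerₛₗ ℝ (u i)) ∘ₗ comb
  have hker : LinearMap.ker F ≠ ⊥ := LinearMap.ker_ne_bot_of_finrank_lt (by simp)
  obtain ⟨a, haF, ha0⟩ := Submodule.exists_mem_ne_zero_of_ne_bot hker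
  set v := comb a with hv
  have hcomb : v = ∑ k, a k • e (κ k) := by
    simp [hv, comb, Fintype.linearCombination_apply]
  have hv0 : v ≠ 0 := fun h0 => by
    have hli : LinearIndependent ℝ fun k => e (κ k) := (e.orthonormal.comp κ hκi).linearIndependent
    rw [hcomb] at h0
    exact ha0 (funext (Fintype.linearIndependent_iff.1 hli a h0))
  have horth : ∀ i, inner ℝ (u i) v = 0 := fun i => by
    have := congrFun (LinearMap.mem_ker.1 haF) i
    simpa [F] using this
  have hzero : ∀ j, j ∉ Set.range κ → inner ℝ (e j) v = 0 := fun j hj => by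
    rw [hcomb, inner_sum]
    refine Finset.sum_eq_zero fun k _ => ?_
    rw [inner_smul_right, e.orthonormal.2 (fun h => hj ⟨k, h.symm⟩), mul_zero]
  have hlow : eigSucc r hA * ‖v‖ ^ 2 ≤ inner ℝ (act A v) v := by
    rw [inner_act_of_orthonormalBasis e _ (act_eigenvectorBasis hA),
      norm_sq_eq_sum_of_orthonormalBasis e, Finset.mul_sum]
    refine Finset.sum_le_sum fun j _ => ?_
    by_cases hj : j ∈ Set.range κ
    · obtain ⟨k, rfl⟩ := hj
      rw [← sq]
      exact mul_le_mul_of_nonneg_right (hval k) (sq_nonneg _)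
    · rw [hzero j hj]
      simp
  exact le_of_mul_le_mul_right (hlow.trans (hc v horth)) (by positivity)

theorem inner_act_of_isSpiked {p r : ℕ} {σ : ℝ} {θ : Fin r → ℝ} {u : Fin r → Vec p} (v w : Vec p) :
    inner ℝ (act (σ ^ 2 • (1 : Mat p) + ∑ i, θ i • outer (u i)) v) w
      = σ ^ 2 * inner ℝ v w + ∑ i, θ i * (inner ℝ (u i) v * inner ℝ (u i) w) := by
  simp only [act_add, act_smul, act_one, act_sum, act_outer, inner_add_left, sum_inner,
    inner_smul_left, conj_trivial]

theorem IsSpiked.isHermitian {p r : ℕ} {σ : ℝ} {Sg : Mat p} (h : IsSpiked r σ Sg) :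
    Sg.IsHermitian := by
  obtain ⟨θ, u, -, -, rfl⟩ := h
  refine isHermitian_of_inner_act_comm fun v w => ?_
  rw [inner_act_of_isSpiked, inner_act_of_isSpiked, real_inner_comm]
  simp only [mul_comm (inner ℝ _ v)]

theorem IsSpiked.le_inner_act {p r : ℕ} {σ : ℝ} {Sg : Mat p} (h : IsSpiked r σ Sg) (v : Vec p) :
    σ ^ 2 * ‖v‖ ^ 2 ≤ inner ℝ (act Sg v) v := by
  obtain ⟨θ, u, hθ, -, rfl⟩ := h
  rw [inner_act_of_isSpiked, real_inner_self_eq_norm_sq]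
  have : 0 ≤ ∑ i, θ i * (inner ℝ (u i) v * inner ℝ (u i) v) :=
    Finset.sum_nonneg fun i _ => mul_nonneg (hθ i) (mul_self_nonneg _)
  linarith

/-- Thresholding is stable at a spiked matrix: if `A` is within `e` of `Sg` as a quadratic form, then
all eigenvalues of `A` are at least `σ² - e` and the `(r+1)`-st one is at most `σ² + e`, so
thresholding moves `A` by at most `2 e`. -/
theorem IsSpiked.threshold_near {p : ℕ} {r : Fin p} {σ e : ℝ} {Sg A : Mat p}
    (h : IsSpiked (r : ℕ) σ Sg) (hA : A.IsHermitian) (he : 0 ≤ e)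
    (hclose : ∀ v : Vec p, |inner ℝ (act A v) v - inner ℝ (act Sg v) v| ≤ e * ‖v‖ ^ 2) :
    (threshold r hA).IsHermitian ∧
    (∀ v : Vec p, |inner ℝ (act (threshold r hA) v) v - inner ℝ (act Sg v) v| ≤ 3 * e * ‖v‖ ^ 2) ∧
    ∀ v : Vec p, (σ ^ 2 - e) * ‖v‖ ^ 2 ≤ inner ℝ (act (threshold r hA) v) v := by
  have hlow := h.le_inner_act
  set b := hA.eigenvectorBasis
  set l := hA.eigenvalues
  set τ := eigSucc r hA with hτ
  have hτle : τ ≤ σ ^ 2 + e := by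
    obtain ⟨θ, u, -, -, rfl⟩ := h
    refine eigSucc_le hA u fun v hv => ?_
    have h1 := (abs_le.1 (hclose v)).2
    have h2 : inner ℝ (act (σ ^ 2 • (1 : Mat p) + ∑ i, θ i • outer (u i)) v) v
        = σ ^ 2 * ‖v‖ ^ 2 := by
      rw [inner_act_of_isSpiked, real_inner_self_eq_norm_sq]
      simp [hv]
    linarith
  have hl : ∀ j, σ ^ 2 - e ≤ l j := fun j => by
    have h1 := (abs_le.1 (hclose (b j))).1
    have h2 := hlow (b j)
    rw [act_eigenvectorBasis hA, inner_smul_left, real_inner_self_eq_norm_sq] at h1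
    have h3 : ‖b j‖ = 1 := b.orthonormal.1 j
    simp only [b, l] at *
    simp only [h3, one_pow, mul_one, conj_trivial] at h1 h2
    linarith
  have hrep := inner_act_of_orthonormalBasis (A := threshold r hA) b (fun j => max (l j) τ)
    (act_cfc_eigenvectorBasis hA _)
  have hrepA := inner_act_of_orthonormalBasis b l (act_eigenvectorBasis hA)
  refine ⟨isHermitian_of_inner_act_comm fun v w => ?_, fun v => ?_, fun v => ?_⟩
  · rw [hrep, hrep]
    exact Finset.sum_congr rfl fun j _ => by ring
  · have h1 : |inner ℝ (act (threshold r hA) v) v - inner ℝ (act A v) v| ≤ 2 * e * ‖v‖ ^ 2 := by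
      rw [hrep, hrepA, ← Finset.sum_sub_distrib, norm_sq_eq_sum_of_orthonormalBasis b,
        Finset.mul_sum]
      refine (Finset.abs_sum_le_sum_abs _ _).trans (Finset.sum_le_sum fun j _ => ?_)
      rw [← sub_mul, abs_mul, ← sq, abs_of_nonneg (sq_nonneg (inner ℝ (b j) v))]
      refine mul_le_mul_of_nonneg_right ?_ (sq_nonneg _)
      rw [abs_of_nonneg (sub_nonneg.2 (le_max_left _ _))]
      rcases max_cases (l j) τ with hm | hm <;> rw [hm.1] <;> linarith [hl j]
    have h2 := hclose v
    rw [abs_le] at *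
    constructor <;> linarith
  · rw [hrep, norm_sq_eq_sum_of_orthonormalBasis b, Finset.mul_sum]
    refine Finset.sum_le_sum fun j _ => ?_
    rw [← sq]
    exact mul_le_mul_of_nonneg_right ((hl j).trans (le_max_left _ _)) (sq_nonneg _)

/-- A coercive matrix is invertible, and the norm of its inverse is at most the reciprocal of the
coercivity constant. -/
theorem act_inv_of_coercive {p : ℕ} {A : Mat p} {c : ℝ} (hc : 0 < c)
    (h : ∀ v : Vec p, c * ‖v‖ ^ 2 ≤ inner ℝ (act A v) v) :
    (∀ v, act A⁻¹ (act A v) = v) ∧ ∀ w, ‖act A⁻¹ w‖ ≤ 1 / c * ‖w‖ := by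
  have hu : IsUnit A := by
    rw [← Matrix.mulVec_injective_iff_isUnit]
    refine (injective_iff_map_eq_zero (Matrix.mulVecLin A)).2 fun x hx => ?_
    have h1 := h (WithLp.toLp 2 x)
    have h2 : act A (WithLp.toLp 2 x) = 0 := by
      rw [act, Matrix.toEuclideanCLM_toLp]
      rw [Matrix.mulVecLin_apply] at hx
      rw [hx]
      rfl
    rw [h2, inner_zero_left] at h1
    have h3 : ‖WithLp.toLp 2 x‖ = 0 := by
      by_contra hne
      have : 0 < ‖WithLp.toLp 2 x‖ ^ 2 := by positivity
      nlinarith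
    simpa using norm_eq_zero.1 h3
  have hdet : IsUnit A.det := (Matrix.isUnit_iff_isUnit_det A).1 hu
  refine ⟨fun v => by rw [← act_mul, Matrix.nonsing_inv_mul _ hdet, act_one], fun w => ?_⟩
  set v := act A⁻¹ w with hv
  have hw : act A v = w := by rw [hv, ← act_mul, Matrix.mul_nonsing_inv _ hdet, act_one]
  have h1 := (h v).trans (real_inner_le_norm _ _)
  rw [hw] at h1
  rw [one_div, ← div_eq_inv_mul, le_div_iff₀ hc]
  rcases (norm_nonneg v).eq_or_lt with h0 | h0
  · rw [← h0]; simp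
  · exact le_of_mul_le_mul_right (by nlinarith) h0

/-- A symmetric operator is bounded by the numerical radius of its quadratic form. -/
theorem norm_apply_le_of_abs_inner_self_le {E : Type*} [NormedAddCommGroup E]
    [InnerProductSpace ℝ E] (T : E →ₗ[ℝ] E) (hT : ∀ v w, inner ℝ (T v) w = inner ℝ (T w) v) {M : ℝ}
    (hM : ∀ v, |inner ℝ (T v) v| ≤ M * ‖v‖ ^ 2) (v : E) : ‖T v‖ ≤ M * ‖v‖ := by
  -- polarization against the vector `w` of the same length as `v` in the direction of `T v`
  rcases eq_or_ne (T v) 0 with h0 | h0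
  · rw [h0, norm_zero]
    rcases (norm_nonneg v).eq_or_lt with hv | hv
    · rw [← hv, mul_zero]
    · have := (abs_nonneg _).trans (hM v)
      exact le_of_mul_le_mul_right (by nlinarith) hv
  have hTv : 0 < ‖T v‖ := norm_pos_iff.2 h0
  have hv : 0 < ‖v‖ := norm_pos_iff.2 fun h => h0 (by rw [h, map_zero])
  set w := (‖v‖ / ‖T v‖) • T v with hw
  have hwn : ‖w‖ = ‖v‖ := by
    rw [hw, norm_smul, Real.norm_of_nonneg (by positivity), div_mul_cancel₀ _ hTv.ne']
  have hin : inner ℝ (T v) w = ‖v‖ * ‖T v‖ := by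
    rw [hw, inner_smul_right, real_inner_self_eq_norm_sq]
    field_simp
  have h1 := (abs_le.1 (hM (v + w))).2
  have h2 := (abs_le.1 (hM (v - w))).1
  have h3 := parallelogram_law_with_norm ℝ v w
  simp only [map_add, map_sub, inner_add_left, inner_add_right, inner_sub_left,
    inner_sub_right] at h1 h2
  rw [hT w v, hin] at h1 h2
  rw [hwn] at h3
  have h4 : 4 * (‖v‖ * ‖T v‖) ≤ M * (‖v + w‖ ^ 2 + ‖v - w‖ ^ 2) := by linarith
  have h5 : ‖v + w‖ ^ 2 + ‖v - w‖ ^ 2 = 4 * ‖v‖ ^ 2 := by linarith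
  rw [h5] at h4
  exact le_of_mul_le_mul_left (by nlinarith) hv

/-! ### A uniform law of large numbers over a random index set -/

/-- The average of `f` over the points `x i` with index in `T`, which is `0` if `T` is
empty. -/
noncomputable def sampleAverage {n : ℕ} {E : Type*} (x : Fin n → E) (T : Finset (Fin n))
    (f : E → ℝ) : ℝ :=
  (1 / (T.card : ℝ)) * ∑ i ∈ T, f (x i)

theorem sampleAverage_sub {n : ℕ} {E : Type*} (x : Fin n → E) (T : Finset (Fin n))
    (f g : E → ℝ) :
    sampleAverage x T f - sampleAverage x T g = sampleAverage x T fun y => f y - g y := by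
  simp only [sampleAverage, ← mul_sub, Finset.sum_sub_distrib]

theorem abs_sampleAverage_le {n : ℕ} {E : Type*} {x : Fin n → E} {T : Finset (Fin n)}
    {f : E → ℝ} {B : ℝ} (hB : 0 ≤ B) (h : ∀ i, |f (x i)| ≤ B) : |sampleAverage x T f| ≤ B := by
  rw [sampleAverage, abs_mul, abs_of_nonneg (by positivity : 0 ≤ 1 / (T.card : ℝ))]
  have h1 : |∑ i ∈ T, f (x i)| ≤ T.card * B := by
    refine (Finset.abs_sum_le_sum_abs _ _).trans ?_
    simpa using Finset.sum_le_card_nsmul T _ B fun i _ => h i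
  rcases T.card.eq_zero_or_pos with h0 | h0
  · simpa [h0] using hB
  · have : (0 : ℝ) < T.card := by exact_mod_cast h0
    rw [one_div, ← div_eq_inv_mul, div_le_iff₀ this]
    linarith

section

variable {E : Type*} [MeasurableSpace E]

/-- Chebyshev's inequality for the average over a fixed index set. -/
theorem measure_abs_sampleAverage_sub_ge_le {Ω : Type*} [MeasurableSpace Ω] {P : Measure Ω}
    [IsProbabilityMeasure P] {law : Measure E} [IsProbabilityMeasure law] {n : ℕ}
    {X : Fin n → Ω → E} (hX : ∀ i, Measurable (X i)) (hlaw : ∀ i, P.map (X i) = law)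
    (hind : iIndepFun X P) {f : E → ℝ} (hf : Measurable f) {B : ℝ} (hB : ∀ᵐ x ∂law, |f x| ≤ B)
    {e : ℝ} (he : 0 < e) {T : Finset (Fin n)} (hT : 0 < T.card) :
    P {ω | e ≤ |sampleAverage (fun i => X i ω) T f - ∫ x, f x ∂law|}
      ≤ ENNReal.ofReal (B ^ 2 / (T.card * e ^ 2)) := by
  have hTr : (0 : ℝ) < T.card := by exact_mod_cast hT
  have hB' : ∀ i, ∀ᵐ ω ∂P, |f (X i ω)| ≤ B := fun i => by
    have := hB
    rw [← hlaw i] at this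
    exact ae_of_ae_map (hX i).aemeasurable this
  have hm : ∀ i, MemLp (fun ω => f (X i ω)) 2 P := fun i =>
    MemLp.of_bound (hf.comp (hX i)).aestronglyMeasurable B (hB' i)
  have hvar : ∀ i, Var[fun ω => f (X i ω); P] ≤ B ^ 2 := fun i => by
    have := variance_le_sq_of_bounded (μ := P) (a := -B) (b := B) (X := fun ω => f (X i ω))
      ((hB' i).mono fun ω h => abs_le.1 h) (hf.comp (hX i)).aemeasurable
    refine this.trans (le_of_eq ?_)
    ring
  have hmean : ∀ i, ∫ ω, f (X i ω) ∂P = ∫ x, f x ∂law := fun i => by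
    rw [← hlaw i, integral_map (hX i).aemeasurable hf.aestronglyMeasurable]
  set Z : Ω → ℝ := fun ω => (1 / (T.card : ℝ)) * (∑ i ∈ T, fun ω => f (X i ω)) ω with hZ
  have hsum : MemLp (∑ i ∈ T, fun ω => f (X i ω)) 2 P := memLp_finsetSum' T fun i _ => hm i
  have hZm : MemLp Z 2 P := hsum.const_mul _
  have hZmean : P[Z] = ∫ x, f x ∂law := by
    rw [hZ, integral_const_mul]
    simp only [Finset.sum_apply]
    rw [integral_finsetSum T fun i _ => (hm i).integrable (by norm_num)]
    simp only [hmean, Finset.sum_const, nsmul_eq_mul]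
    field_simp
  have hZvar : Var[Z; P] ≤ B ^ 2 / T.card := by
    rw [hZ, variance_const_mul, IndepFun.variance_sum (fun i _ => hm i)]
    · have : ∑ i ∈ T, Var[fun ω => f (X i ω); P] ≤ T.card * B ^ 2 := by
        simpa using Finset.sum_le_card_nsmul T _ (B ^ 2) fun i _ => hvar i
      calc (1 / (T.card : ℝ)) ^ 2 * ∑ i ∈ T, Var[fun ω => f (X i ω); P]
          ≤ (1 / (T.card : ℝ)) ^ 2 * (T.card * B ^ 2) := by gcongr
        _ = B ^ 2 / T.card := by field_simp
    · intro i _ j _ hij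
      exact (hind.indepFun hij).comp hf hf
  have := meas_ge_le_variance_div_sq hZm he
  rw [hZmean] at this
  have hset : {ω | e ≤ |sampleAverage (fun i => X i ω) T f - ∫ x, f x ∂law|}
      = {ω | e ≤ |Z ω - ∫ x, f x ∂law|} := by
    ext ω
    simp [hZ, sampleAverage]
  rw [hset]
  refine this.trans (ENNReal.ofReal_le_ofReal ?_)
  rw [← div_div]
  gcongr

/-- Chebyshev's inequality for the average over a random index set independent of the sample. -/
theorem measure_abs_sampleAverage_sub_ge_le_of_indepFun {Ω : Type*} [MeasurableSpace Ω]
    {P : Measure Ω} [IsProbabilityMeasure P] {law : Measure E} [IsProbabilityMeasure law] {n : ℕ}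
    {X : Fin n → Ω → E} (hX : ∀ i, Measurable (X i)) (hlaw : ∀ i, P.map (X i) = law)
    (hind : iIndepFun X P) {T : Ω → Finset (Fin n)} (hTm : Measurable T)
    (hTX : IndepFun T (fun ω i => X i ω) P) {N : ℕ} (hN : 0 < N)
    (hTN : ∀ᵐ ω ∂P, N ≤ (T ω).card) {f : E → ℝ} (hf : Measurable f) {B : ℝ}
    (hB : ∀ᵐ x ∂law, |f x| ≤ B) {e : ℝ} (he : 0 < e) :
    P {ω | e ≤ |sampleAverage (fun i => X i ω) (T ω) f - ∫ x, f x ∂law|}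
      ≤ ENNReal.ofReal (B ^ 2 / (N * e ^ 2)) := by
  classical
  set D : Finset (Fin n) → Set (Fin n → E) := fun t =>
    {x | e ≤ |sampleAverage x t f - ∫ x, f x ∂law|} with hD
  have hDm : ∀ t, MeasurableSet (D t) := fun t => by
    refine measurableSet_le measurable_const ?_
    unfold sampleAverage
    fun_prop
  set I : Finset (Finset (Fin n)) := Finset.univ.filter fun t => N ≤ t.card with hI
  have hNr : (0 : ℝ) < N := by exact_mod_cast hN
  have hsub : {ω | e ≤ |sampleAverage (fun i => X i ω) (T ω) f - ∫ x, f x ∂law|}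
      ≤ᵐ[P] ⋃ t ∈ I, (T ⁻¹' {t} ∩ (fun ω i => X i ω) ⁻¹' D t) := by
    filter_upwards [hTN] with ω hω hdev
    exact Set.mem_iUnion₂.2 ⟨T ω, by simpa [hI] using hω, rfl, hdev⟩
  calc P {ω | e ≤ |sampleAverage (fun i => X i ω) (T ω) f - ∫ x, f x ∂law|}
      ≤ P (⋃ t ∈ I, (T ⁻¹' {t} ∩ (fun ω i => X i ω) ⁻¹' D t)) := measure_mono_ae hsub
    _ ≤ ∑ t ∈ I, P (T ⁻¹' {t} ∩ (fun ω i => X i ω) ⁻¹' D t) := measure_biUnion_finset_le _ _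
    _ ≤ ∑ t ∈ I, P (T ⁻¹' {t}) * ENNReal.ofReal (B ^ 2 / (N * e ^ 2)) := by
        refine Finset.sum_le_sum fun t ht => ?_
        have htN : N ≤ t.card := by simpa [hI] using ht
        rw [hTX.measure_inter_preimage_eq_mul _ _ trivial (hDm t)]
        gcongr
        refine (measure_abs_sampleAverage_sub_ge_le hX hlaw hind hf hB he
          (hN.trans_le htN)).trans (ENNReal.ofReal_le_ofReal ?_)
        have : (N : ℝ) ≤ t.card := by exact_mod_cast htN
        gcongr
    _ = P (⋃ t ∈ I, T ⁻¹' {t}) * ENNReal.ofReal (B ^ 2 / (N * e ^ 2)) := by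
        rw [← Finset.sum_mul, measure_biUnion_finset _ fun t _ => hTm trivial]
        intro t _ t' _ htt'
        exact Set.disjoint_left.2 fun ω h h' => htt' (by
          rw [Set.mem_preimage, Set.mem_singleton_iff] at h h'
          rw [← h, ← h'])
    _ ≤ ENNReal.ofReal (B ^ 2 / (N * e ^ 2)) := by
        refine mul_le_of_le_one_left' prob_le_one

/-- A uniform law of large numbers: for a totally bounded set of parameters and a class of functions
with given bound and Lipschitz constant in the parameter, the sample size needed depends on these
data only, not on the law or the functions. -/
theorem exists_uniform_sampleAverage {Θ : Type*} [PseudoMetricSpace Θ] {C : Set Θ}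
    (hC : TotallyBounded C) (B : ℝ) {L e τ : ℝ} (hL : 0 ≤ L) (he : 0 < e) (hτ : 0 < τ) :
    ∃ N : ℕ, ∀ (law : Measure E) [IsProbabilityMeasure law] (F : Θ → E → ℝ),
      (∀ θ ∈ C, Measurable (F θ)) → (∀ᵐ x ∂law, ∀ θ ∈ C, |F θ x| ≤ B) →
      (∀ᵐ x ∂law, ∀ θ ∈ C, ∀ θ' ∈ C, |F θ x - F θ' x| ≤ L * dist θ θ') →
      ∀ (Ω : Type*) [MeasurableSpace Ω] (P : Measure Ω) [IsProbabilityMeasure P] (n : ℕ)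
        (X : Fin n → Ω → E) (T : Ω → Finset (Fin n)), (∀ i, Measurable (X i)) →
      (∀ i, P.map (X i) = law) → iIndepFun X P → Measurable T →
      IndepFun T (fun ω i => X i ω) P → (∀ᵐ ω ∂P, N ≤ (T ω).card) →
      P {ω | ∃ θ ∈ C, e < |sampleAverage (fun i => X i ω) (T ω) (F θ) - ∫ x, F θ x ∂law|}
        ≤ ENNReal.ofReal τ := by
  -- a finite net of `C` on which Chebyshev's inequality is summed
  obtain ⟨D, hDC, hDfin, hDcov⟩ :=
    Metric.finite_approx_of_totallyBounded hC (e / (4 * (L + 1))) (by positivity)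
  obtain ⟨M, hM⟩ := exists_nat_gt (hDfin.toFinset.card * B ^ 2 / ((e / 2) ^ 2 * τ))
  refine ⟨M + 1, fun law _ F hFm hFB hFL Ω _ P _ n X T hX hlaw hind hTm hTX hTN => ?_⟩
  have hXL : ∀ᵐ ω ∂P, ∀ i, ∀ θ ∈ C, ∀ θ' ∈ C,
      |F θ (X i ω) - F θ' (X i ω)| ≤ L * dist θ θ' := ae_all_iff.2 fun i => by
    rw [← hlaw i] at hFL
    exact ae_of_ae_map (hX i).aemeasurable hFL
  have hint : ∀ θ ∈ C, Integrable (F θ) law := fun θ hθ =>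
    Integrable.of_bound (hFm θ hθ).aestronglyMeasurable B (hFB.mono fun x h => h θ hθ)
  have hsub : {ω | ∃ θ ∈ C,
        e < |sampleAverage (fun i => X i ω) (T ω) (F θ) - ∫ x, F θ x ∂law|}
      ≤ᵐ[P] ⋃ d ∈ hDfin.toFinset,
        {ω | e / 2 ≤ |sampleAverage (fun i => X i ω) (T ω) (F d) - ∫ x, F d x ∂law|} := by
    filter_upwards [hXL] with ω hω hdev
    obtain ⟨θ, hθ, hdev⟩ := hdev
    obtain ⟨d, hd, hdist⟩ := Set.mem_iUnion₂.1 (hDcov hθ)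
    rw [Metric.mem_ball] at hdist
    have hLd : L * dist θ d ≤ e / 4 := by
      calc L * dist θ d ≤ (L + 1) * (e / (4 * (L + 1))) := by gcongr; linarith
        _ = e / 4 := by field_simp
    have h1 : |sampleAverage (fun i => X i ω) (T ω) (F θ)
        - sampleAverage (fun i => X i ω) (T ω) (F d)| ≤ e / 4 := by
      rw [sampleAverage_sub]
      exact abs_sampleAverage_le (by positivity) fun i => (hω i θ hθ d (hDC hd)).trans hLd
    have h2 : |(∫ x, F θ x ∂law) - ∫ x, F d x ∂law| ≤ e / 4 := by
      rw [← integral_sub (hint θ hθ) (hint d (hDC hd))]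
      have := norm_integral_le_of_norm_le_const (μ := law) (f := fun x => F θ x - F d x)
        (C := e / 4) (hFL.mono fun x h => (h θ hθ d (hDC hd)).trans hLd)
      simpa using this
    refine Set.mem_iUnion₂.2 ⟨d, hDfin.mem_toFinset.2 hd, ?_⟩
    change e / 2 ≤ |sampleAverage (fun i => X i ω) (T ω) (F d) - ∫ x, F d x ∂law|
    set a := sampleAverage (fun i => X i ω) (T ω) (F θ)
    set a' := sampleAverage (fun i => X i ω) (T ω) (F d)
    set m := ∫ x, F θ x ∂law
    set m' := ∫ x, F d x ∂law
    have h3 : |a - m| ≤ |a - a'| + |a' - m'| + |m - m'| := by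
      have : a - m = (a - a') + (a' - m') + (-(m - m')) := by ring
      rw [this]
      refine (abs_add_three _ _ _).trans (by rw [abs_neg])
    linarith
  calc P {ω | ∃ θ ∈ C,
        e < |sampleAverage (fun i => X i ω) (T ω) (F θ) - ∫ x, F θ x ∂law|}
      ≤ P (⋃ d ∈ hDfin.toFinset,
        {ω | e / 2 ≤ |sampleAverage (fun i => X i ω) (T ω) (F d) - ∫ x, F d x ∂law|}) :=
        measure_mono_ae hsub
    _ ≤ ∑ d ∈ hDfin.toFinset,
        P {ω | e / 2 ≤ |sampleAverage (fun i => X i ω) (T ω) (F d) - ∫ x, F d x ∂law|} :=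
        measure_biUnion_finset_le _ _
    _ ≤ ∑ d ∈ hDfin.toFinset, ENNReal.ofReal (B ^ 2 / ((M + 1 : ℕ) * (e / 2) ^ 2)) := by
        refine Finset.sum_le_sum fun d hd => ?_
        have hdC := hDC (hDfin.mem_toFinset.1 hd)
        exact measure_abs_sampleAverage_sub_ge_le_of_indepFun hX hlaw hind hTm hTX M.succ_pos hTN
          (hFm d hdC) (hFB.mono fun x h => h d hdC) (by positivity)
    _ = ENNReal.ofReal (hDfin.toFinset.card * (B ^ 2 / ((M + 1 : ℕ) * (e / 2) ^ 2))) := by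
        rw [Finset.sum_const, nsmul_eq_mul, ENNReal.ofReal_mul (by positivity),
          ENNReal.ofReal_natCast]
    _ ≤ ENNReal.ofReal τ := by
        refine ENNReal.ofReal_le_ofReal ?_
        rw [div_lt_iff₀ (by positivity)] at hM
        rw [← mul_div_assoc, div_le_iff₀ (by positivity)]
        push_cast
        have : 0 ≤ (e / 2) ^ 2 * τ := by positivity
        linarith

end

/-! ### Quadratic forms of the population -/

/-- A bound for a quadratic function on the unit sphere extends to the whole space. -/
theorem abs_le_mul_norm_sq_of_unit {p : ℕ} {q : Vec p → ℝ}
    (hq : ∀ (c : ℝ) (v : Vec p), q (c • v) = c ^ 2 * q v) {M : ℝ}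
    (h : ∀ v : Vec p, ‖v‖ = 1 → |q v| ≤ M) (v : Vec p) : |q v| ≤ M * ‖v‖ ^ 2 := by
  rcases eq_or_ne v 0 with rfl | hv
  · have h0 : q 0 = 0 := by
      have := hq 0 0
      rw [smul_zero] at this
      linarith
    rw [h0, norm_zero]
    simp
  have hv' : ‖v‖ ≠ 0 := norm_ne_zero_iff.2 hv
  have h1 := h (‖v‖⁻¹ • v) (by rw [norm_smul, norm_inv, norm_norm, inv_mul_cancel₀ hv'])
  have h2 := hq ‖v‖ (‖v‖⁻¹ • v)
  rw [smul_smul, mul_inv_cancel₀ hv', one_smul] at h2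
  rw [h2, abs_mul, abs_of_nonneg (sq_nonneg ‖v‖), mul_comm]
  gcongr

theorem norm_act_le_of_abs_inner_self_le {p : ℕ} {A : Mat p} (hA : A.IsHermitian) {M : ℝ}
    (hM : ∀ v : Vec p, |inner ℝ (act A v) v| ≤ M * ‖v‖ ^ 2) (v : Vec p) :
    ‖act A v‖ ≤ M * ‖v‖ :=
  norm_apply_le_of_abs_inner_self_le (Matrix.toEuclideanCLM (𝕜 := ℝ) A).toLinearMap
    (inner_act_comm hA) hM v

theorem IsSpiked.posSemidef {p r : ℕ} {σ : ℝ} {Sg : Mat p} (h : IsSpiked r σ Sg) :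
    Sg.PosSemidef := by
  refine Matrix.PosSemidef.of_dotProduct_mulVec_nonneg h.isHermitian fun x => ?_
  have h1 : 0 ≤ inner ℝ (act Sg (WithLp.toLp 2 x)) (WithLp.toLp 2 x) :=
    (by positivity : 0 ≤ σ ^ 2 * ‖WithLp.toLp 2 x‖ ^ 2).trans (h.le_inner_act _)
  refine h1.trans (le_of_eq ?_)
  rw [inner_act]
  simp only [dotProduct, Matrix.mulVec, Finset.mul_sum, star_trivial, Pi.star_apply]
  exact Finset.sum_congr rfl fun i _ => Finset.sum_congr rfl fun j _ => by ring

theorem le_probMetric {p : ℕ} {law : Measure (Vec p)} {H : Set (Vec p → ℝ)}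
    {law' : Measure (Vec p)} {M : ℝ}
    (hM : ∀ h ∈ H, |(∫ v, h v ∂law) - ∫ v, h v ∂law'| ≤ M) {h : Vec p → ℝ} (hh : h ∈ H) :
    |(∫ v, h v ∂law) - ∫ v, h v ∂law'| ≤ probMetric H law law' :=
  le_csSup ⟨M, by rintro _ ⟨g, hg, rfl⟩; exact hM g hg⟩ ⟨h, hh, rfl⟩

theorem probMetric_nonneg {p : ℕ} (H : Set (Vec p → ℝ)) (law law' : Measure (Vec p)) :
    0 ≤ probMetric H law law' :=
  Real.sSup_nonneg (by rintro _ ⟨g, -, rfl⟩; exact abs_nonneg _)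

theorem gaussDist_nonneg {p : ℕ} (φ : ℝ → ℝ) (R : ℝ) (law : Measure (Vec p)) (Sg : Mat p) :
    0 ≤ gaussDist φ R law Sg := by
  have := specNorm_nonneg Sg
  have h1 := probMetric_nonneg (derivClass p φ 2 R) law (multivariateGaussian 0 Sg)
  have h2 := probMetric_nonneg (derivClass p φ 4 R) law (multivariateGaussian 0 Sg)
  have h3 := probMetric_nonneg (hessClass p φ R) law (multivariateGaussian 0 Sg)
  unfold gaussDist
  positivity

section

variable {p : ℕ} {law : Measure (Vec p)} [IsProbabilityMeasure law] {Sg : Mat p} {K : ℝ}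

theorem HasSecondMoment.inner_act_eq_integral (h : HasSecondMoment law Sg)
    (hK : ∀ᵐ v ∂law, ‖v‖ ≤ Real.sqrt K) (v w : Vec p) :
    inner ℝ (act Sg v) w = ∫ x, inner ℝ v x * inner ℝ w x ∂law := by
  have hint : ∀ i j : Fin p, Integrable (fun x : Vec p => x i * x j) law := fun i j => by
    refine Integrable.of_bound (by fun_prop) (Real.sqrt K * Real.sqrt K) ?_
    filter_upwards [hK] with x hx
    rw [norm_mul]
    exact mul_le_mul ((PiLp.norm_apply_le x i).trans hx) ((PiLp.norm_apply_le x j).trans hx)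
      (norm_nonneg _) (Real.sqrt_nonneg _)
  have hexp : ∀ x : Vec p, inner ℝ v x * inner ℝ w x = ∑ i, ∑ j, v j * w i * (x i * x j) :=
    fun x => by
      simp only [PiLp.inner_apply, RCLike.inner_apply, conj_trivial, Finset.sum_mul_sum]
      rw [Finset.sum_comm]
      exact Finset.sum_congr rfl fun i _ => Finset.sum_congr rfl fun j _ => by ring
  rw [inner_act]
  simp only [hexp]
  rw [integral_finsetSum _ fun i _ => integrable_finsetSum _ fun j _ => (hint i j).const_mul _]
  refine Finset.sum_congr rfl fun i _ => ?_
  rw [integral_finsetSum _ fun j _ => (hint i j).const_mul _]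
  refine Finset.sum_congr rfl fun j _ => ?_
  rw [integral_const_mul, h i j]
  ring

theorem inner_sq_le_of_norm_le {p : ℕ} {K : ℝ} (hK : 0 ≤ K) {v x : Vec p}
    (hx : ‖x‖ ≤ Real.sqrt K) : inner ℝ v x ^ 2 ≤ K * ‖v‖ ^ 2 := by
  calc inner ℝ v x ^ 2 = |inner ℝ v x| ^ 2 := (sq_abs _).symm
    _ ≤ (‖v‖ * Real.sqrt K) ^ 2 := by
        gcongr
        exact (abs_real_inner_le_norm v x).trans (by gcongr)
    _ = K * ‖v‖ ^ 2 := by rw [mul_pow, Real.sq_sqrt hK, mul_comm]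

theorem HasSecondMoment.inner_act_self_le (h : HasSecondMoment law Sg) (hK0 : 0 ≤ K)
    (hK : ∀ᵐ v ∂law, ‖v‖ ≤ Real.sqrt K) (v : Vec p) :
    |inner ℝ (act Sg v) v| ≤ K * ‖v‖ ^ 2 := by
  rw [h.inner_act_eq_integral hK]
  have := norm_integral_le_of_norm_le_const (μ := law)
    (f := fun x => inner ℝ v x * inner ℝ v x) (C := K * ‖v‖ ^ 2) (hK.mono fun x hx => by
      rw [← sq, Real.norm_of_nonneg (sq_nonneg _)]
      exact inner_sq_le_of_norm_le hK0 hx)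
  simpa using this

/-- Bounded covariates force a bounded dimension: the trace of the covariance is at most `K`, and it
is at least `p σ²`. -/
theorem HasSecondMoment.card_mul_sq_le (h : HasSecondMoment law Sg) (hK0 : 0 ≤ K)
    (hK : ∀ᵐ v ∂law, ‖v‖ ≤ Real.sqrt K) {r : ℕ} {σ : ℝ} (hs : IsSpiked r σ Sg) :
    p * σ ^ 2 ≤ K := by
  set b := EuclideanSpace.basisFun (Fin p) ℝ
  have h1 : ∀ j, σ ^ 2 ≤ ∫ x, inner ℝ (b j) x * inner ℝ (b j) x ∂law := fun j => by
    rw [← h.inner_act_eq_integral hK]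
    have := hs.le_inner_act (b j)
    rwa [b.orthonormal.1 j, one_pow, mul_one] at this
  have hint : ∀ j, Integrable (fun x => inner ℝ (b j) x * inner ℝ (b j) x) law := fun j => by
    refine Integrable.of_bound (by fun_prop) (K * ‖b j‖ ^ 2) (hK.mono fun x hx => ?_)
    rw [← sq, Real.norm_of_nonneg (sq_nonneg _)]
    exact inner_sq_le_of_norm_le hK0 hx
  calc (p : ℝ) * σ ^ 2 = ∑ _j : Fin p, σ ^ 2 := by simp
    _ ≤ ∑ j, ∫ x, inner ℝ (b j) x * inner ℝ (b j) x ∂law := Finset.sum_le_sum fun j _ => h1 j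
    _ = ∫ x, ‖x‖ ^ 2 ∂law := by
        rw [← integral_finsetSum _ fun j _ => hint j]
        congr 1
        ext x
        rw [norm_sq_eq_sum_of_orthonormalBasis b]
        exact Finset.sum_congr rfl fun j _ => (sq _).symm
    _ ≤ K := by
        have := norm_integral_le_of_norm_le_const (μ := law) (f := fun x : Vec p => ‖x‖ ^ 2)
          (C := K) (hK.mono fun x hx => by
            rw [Real.norm_of_nonneg (sq_nonneg _), ← Real.sq_sqrt hK0]
            gcongr)
        refine (le_abs_self _).trans (by simpa using this)

theorem abs_integral_le_of_abs_le {E : Type*} [MeasurableSpace E] {μ : Measure E}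
    [IsProbabilityMeasure μ] {f : E → ℝ} {B : ℝ} (h : ∀ x, |f x| ≤ B) : |∫ x, f x ∂μ| ≤ B := by
  simpa using norm_integral_le_of_norm_le_const (μ := μ) (f := f) (C := B) (ae_of_all _ h)

/-- The distance `𝔇` bounds the error of the Stein approximation of the population Hessian: the
approximation is exact for the Gaussian law, by Stein's identity, and each of its three expectations
is compared with the law of the covariates. -/
theorem abs_stein_hessian_sub_le {φ : ℝ → ℝ} (hφ : ∀ k : ℕ, ContDiff ℝ k φ) {R B₂ B₃ B₄ : ℝ}
    (hK0 : 0 ≤ K) (h₂ : ∀ w, |iteratedDeriv 2 φ w| ≤ B₂)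
    (h₃ : ∀ w, |iteratedDeriv 3 φ w| ≤ B₃) (h₄ : ∀ w, |iteratedDeriv 4 φ w| ≤ B₄)
    (hK : ∀ᵐ v ∂law, ‖v‖ ≤ Real.sqrt K) {r : ℕ} {σ : ℝ} (hs : IsSpiked r σ Sg)
    {b : Vec p} (hb : ‖b‖ ≤ R) (v : Vec p) :
    |mu φ 2 law b * inner ℝ (act Sg v) v + mu φ 4 law b * inner ℝ (act Sg b) v ^ 2
        - ∫ x, inner ℝ v x ^ 2 * iteratedDeriv 2 φ (inner ℝ x b) ∂law|
      ≤ gaussDist φ R law Sg * ‖v‖ ^ 2 := by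
  set G := multivariateGaussian 0 Sg with hG
  have hB₂ : 0 ≤ B₂ := (abs_nonneg _).trans (h₂ 0)
  have hB₄ : 0 ≤ B₄ := (abs_nonneg _).trans (h₄ 0)
  have hstein : ∀ b v : Vec p, ∫ z, inner ℝ v z ^ 2 * iteratedDeriv 2 φ (inner ℝ z b) ∂G
      = inner ℝ (act Sg v) v * ∫ z, iteratedDeriv 2 φ (inner ℝ z b) ∂G +
        inner ℝ (act Sg b) v ^ 2 * ∫ z, iteratedDeriv 4 φ (inner ℝ z b) ∂G := fun b v =>
    integral_sq_mul_multivariateGaussian hs.posSemidef b v (hasDerivAt_iteratedDeriv hφ 2)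
      (hasDerivAt_iteratedDeriv hφ 3) ((hφ 4).continuous_iteratedDeriv 4 le_rfl) h₂ h₃ h₄
  have hlin : ∀ v : Vec p, ‖v‖ = 1 → |inner ℝ (act Sg v) v| ≤ specNorm Sg := fun v hv => by
    refine (abs_real_inner_le_norm _ _).trans ?_
    have := norm_act_le Sg v
    rwa [hv, mul_one] at this ⊢
  have hsq : ∀ b v : Vec p, ‖b‖ ≤ R → ‖v‖ = 1 → inner ℝ (act Sg b) v ^ 2
      ≤ specNorm Sg ^ 2 * R ^ 2 := fun b v hb hv => by
    have h1 : |inner ℝ (act Sg b) v| ≤ specNorm Sg * R := by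
      refine (abs_real_inner_le_norm _ _).trans ?_
      rw [hv, mul_one]
      exact (norm_act_le Sg b).trans (mul_le_mul_of_nonneg_left hb (specNorm_nonneg _))
    rw [← sq_abs, ← mul_pow]
    gcongr
  have hD₂ : |mu φ 2 law b - ∫ z, iteratedDeriv 2 φ (inner ℝ z b) ∂G|
      ≤ probMetric (derivClass p φ 2 R) law G := by
    refine le_probMetric (M := B₂ + B₂) ?_ ⟨b, hb, rfl⟩
    rintro _ ⟨b', -, rfl⟩
    exact (abs_sub _ _).trans (add_le_add (abs_integral_le_of_abs_le fun _ => h₂ _)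
      (abs_integral_le_of_abs_le fun _ => h₂ _))
  have hD₄ : |mu φ 4 law b - ∫ z, iteratedDeriv 4 φ (inner ℝ z b) ∂G|
      ≤ probMetric (derivClass p φ 4 R) law G := by
    refine le_probMetric (M := B₄ + B₄) ?_ ⟨b, hb, rfl⟩
    rintro _ ⟨b', -, rfl⟩
    exact (abs_sub _ _).trans (add_le_add (abs_integral_le_of_abs_le fun _ => h₄ _)
      (abs_integral_le_of_abs_le fun _ => h₄ _))
  have hDH : ∀ v : Vec p, ‖v‖ = 1 →
      |(∫ x, inner ℝ v x ^ 2 * iteratedDeriv 2 φ (inner ℝ x b) ∂law)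
        - ∫ z, inner ℝ v z ^ 2 * iteratedDeriv 2 φ (inner ℝ z b) ∂G|
      ≤ probMetric (hessClass p φ R) law G := fun v hv => by
    refine le_probMetric
      (M := K * B₂ + (specNorm Sg * B₂ + specNorm Sg ^ 2 * R ^ 2 * B₄)) ?_ ⟨b, v, hb, hv, rfl⟩
    rintro _ ⟨b', v', hb', hv', rfl⟩
    refine (abs_sub _ _).trans (add_le_add ?_ ?_)
    · have := norm_integral_le_of_norm_le_const (μ := law)
        (f := fun x => inner ℝ v' x ^ 2 * iteratedDeriv 2 φ (inner ℝ x b')) (C := K * B₂)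
        (hK.mono fun x hx => by
          rw [norm_mul, Real.norm_of_nonneg (sq_nonneg _)]
          have := inner_sq_le_of_norm_le hK0 (v := v') hx
          rw [hv', one_pow, mul_one] at this
          exact mul_le_mul this (h₂ _) (norm_nonneg _) hK0)
      simpa using this
    · rw [hstein]
      refine (abs_add_le _ _).trans (add_le_add ?_ ?_)
      · rw [abs_mul]
        exact mul_le_mul (hlin v' hv') (abs_integral_le_of_abs_le fun _ => h₂ _) (abs_nonneg _)
          (specNorm_nonneg _)
      · rw [abs_mul, abs_of_nonneg (sq_nonneg (inner ℝ (act Sg b') v'))]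
        exact mul_le_mul (hsq b' v' hb' hv') (abs_integral_le_of_abs_le fun _ => h₄ _)
          (abs_nonneg _) (by positivity)
  refine abs_le_mul_norm_sq_of_unit (q := fun v =>
    mu φ 2 law b * inner ℝ (act Sg v) v + mu φ 4 law b * inner ℝ (act Sg b) v ^ 2
        - ∫ x, inner ℝ v x ^ 2 * iteratedDeriv 2 φ (inner ℝ x b) ∂law) ?_ ?_ v
  · intro c v
    simp only [act_smul_right, inner_smul_left, inner_smul_right, conj_trivial, mul_pow]
    simp only [mul_assoc]
    rw [integral_const_mul]
    ring
  · intro v hv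
    have e2 := hDH v hv
    rw [hstein] at e2
    set z2 := ∫ z, iteratedDeriv 2 φ (inner ℝ z b) ∂G
    set z4 := ∫ z, iteratedDeriv 4 φ (inner ℝ z b) ∂G
    set J := ∫ x, inner ℝ v x ^ 2 * iteratedDeriv 2 φ (inner ℝ x b) ∂law
    set α := inner ℝ (act Sg v) v with hα
    set γ := inner ℝ (act Sg b) v with hγ
    have e0 : |(mu φ 2 law b - z2) * α| ≤ specNorm Sg * probMetric (derivClass p φ 2 R) law G := by
      rw [abs_mul, mul_comm]
      exact mul_le_mul (hlin v hv) hD₂ (abs_nonneg _) (specNorm_nonneg _)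
    have e1 : |(mu φ 4 law b - z4) * γ ^ 2|
        ≤ specNorm Sg ^ 2 * R ^ 2 * probMetric (derivClass p φ 4 R) law G := by
      rw [abs_mul, mul_comm, abs_of_nonneg (sq_nonneg γ)]
      exact mul_le_mul (hsq b v hb hv) hD₄ (abs_nonneg _) (by positivity)
    have : mu φ 2 law b * α + mu φ 4 law b * γ ^ 2 - J
        = (mu φ 2 law b - z2) * α + (mu φ 4 law b - z4) * γ ^ 2
          + -(J - (α * z2 + γ ^ 2 * z4)) := by ring
    rw [this]
    refine (abs_add_three _ _ _).trans ?_
    rw [abs_neg]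
    exact add_le_add (add_le_add e0 e1) e2

end

/-! ### One step of the iteration -/

/-- The Hessian `n⁻¹ ∑ φ''(⟨x_i, b⟩) x_i x_iᵀ` of the negative log-likelihood. -/
noncomputable def sampleHessian {p n : ℕ} (φ : ℝ → ℝ) (X : Fin n → Vec p) (b : Vec p) : Mat p :=
  (1 / (n : ℝ)) • ∑ i, iteratedDeriv 2 φ (inner ℝ (X i) b) • outer (X i)

theorem act_sampleHessian {p n : ℕ} (φ : ℝ → ℝ) (X : Fin n → Vec p) (b v : Vec p) :
    act (sampleHessian φ X b) v
      = (1 / (n : ℝ)) • ∑ i, (iteratedDeriv 2 φ (inner ℝ (X i) b) * inner ℝ (X i) v) • X i := by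
  simp only [sampleHessian, act_smul, act_sum, act_outer, smul_smul]

theorem inner_act_sampleHessian {p n : ℕ} (φ : ℝ → ℝ) (X : Fin n → Vec p) (b v w : Vec p) :
    inner ℝ (act (sampleHessian φ X b) v) w = (1 / (n : ℝ)) *
      ∑ i, iteratedDeriv 2 φ (inner ℝ (X i) b) * inner ℝ (X i) v * inner ℝ (X i) w := by
  rw [act_sampleHessian, inner_smul_left, sum_inner]
  simp [inner_smul_left]

theorem sampleHessian_isHermitian {p n : ℕ} (φ : ℝ → ℝ) (X : Fin n → Vec p) (b : Vec p) :
    (sampleHessian φ X b).IsHermitian := by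
  refine isHermitian_of_inner_act_comm fun v w => ?_
  rw [inner_act_sampleHessian, inner_act_sampleHessian]
  simp only [mul_assoc, mul_comm (inner ℝ _ v)]

theorem norm_average_le {E : Type*} [NormedAddCommGroup E] [NormedSpace ℝ E] {n : ℕ}
    {f : Fin n → E} {B : ℝ} (hB : 0 ≤ B) (h : ∀ i, ‖f i‖ ≤ B) :
    ‖(1 / (n : ℝ)) • ∑ i, f i‖ ≤ B := by
  rw [norm_smul, Real.norm_of_nonneg (by positivity)]
  have h1 : ‖∑ i, f i‖ ≤ n * B := by
    refine (norm_sum_le _ _).trans ?_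
    simpa using Finset.sum_le_card_nsmul Finset.univ (fun i => ‖f i‖) B fun i _ => h i
  rcases n.eq_zero_or_pos with h0 | h0
  · subst h0
    simpa using hB
  · have : (0 : ℝ) < n := by exact_mod_cast h0
    rw [one_div, ← div_eq_inv_mul, div_le_iff₀ this]
    linarith

theorem abs_muHat_le {p n : ℕ} {φ : ℝ → ℝ} {k : ℕ} {B : ℝ} (h : ∀ w, |iteratedDeriv k φ w| ≤ B)
    (X : Fin n → Vec p) (b : Vec p) : |muHat φ k X b| ≤ B :=
  norm_average_le (E := ℝ) ((abs_nonneg _).trans (h 0)) fun _ => h _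

/-- The gradient increment is the Hessian at the current point applied to the displacement, up to a
remainder that is quadratic in the displacement. -/
theorem norm_gradNegLogLik_sub_le {p n : ℕ} {φ : ℝ → ℝ} (hφ : ∀ k : ℕ, ContDiff ℝ k φ) {K L : ℝ}
    (hL : ∀ w, |iteratedDeriv 3 φ w| ≤ L) {X : Fin n → Vec p}
    (hX : ∀ i, ‖X i‖ ≤ Real.sqrt K) (Y : Fin n → ℝ) (b c : Vec p) :
    ‖gradNegLogLik φ X Y b - gradNegLogLik φ X Y c - act (sampleHessian φ X b) (b - c)‖
      ≤ L * Real.sqrt K ^ 3 * ‖b - c‖ ^ 2 := by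
  have hL0 : 0 ≤ L := (abs_nonneg _).trans (hL 0)
  have heq : gradNegLogLik φ X Y b - gradNegLogLik φ X Y c - act (sampleHessian φ X b) (b - c)
      = (1 / (n : ℝ)) • ∑ i, (-(deriv φ (inner ℝ (X i) c) - deriv φ (inner ℝ (X i) b)
          - iteratedDeriv 2 φ (inner ℝ (X i) b) * (inner ℝ (X i) c - inner ℝ (X i) b))) • X i := by
    rw [act_sampleHessian]
    simp only [gradNegLogLik, ← smul_sub, ← Finset.sum_sub_distrib, ← sub_smul]
    congr 1
    refine Finset.sum_congr rfl fun i _ => ?_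
    rw [inner_sub_right]
    congr 1
    ring
  rw [heq]
  refine norm_average_le (by positivity) fun i => ?_
  have htaylor := abs_sub_sub_mul_le (hasDerivAt_iteratedDeriv hφ 1) (hasDerivAt_iteratedDeriv hφ 2)
    hL (inner ℝ (X i) b) (inner ℝ (X i) c)
  simp only [iteratedDeriv_one] at htaylor
  have hsq : (inner ℝ (X i) c - inner ℝ (X i) b) ^ 2 ≤ Real.sqrt K ^ 2 * ‖b - c‖ ^ 2 := by
    rw [← inner_sub_right, ← sq_abs, ← mul_pow]
    gcongr
    refine (abs_real_inner_le_norm _ _).trans ?_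
    rw [norm_sub_rev c b]
    gcongr
    exact hX i
  rw [norm_smul, norm_neg, Real.norm_eq_abs]
  calc |deriv φ (inner ℝ (X i) c) - deriv φ (inner ℝ (X i) b)
          - iteratedDeriv 2 φ (inner ℝ (X i) b) * (inner ℝ (X i) c - inner ℝ (X i) b)| * ‖X i‖
      ≤ (L * (Real.sqrt K ^ 2 * ‖b - c‖ ^ 2)) * Real.sqrt K := by
        refine mul_le_mul (htaylor.trans (by gcongr)) (hX i) (norm_nonneg _) (by positivity)
    _ = L * Real.sqrt K ^ 3 * ‖b - c‖ ^ 2 := by ring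

theorem norm_projBall_le {p : ℕ} {R : ℝ} (hR : 0 ≤ R) (v : Vec p) : ‖projBall R v‖ ≤ R := by
  unfold projBall
  split_ifs with h
  · exact h
  · have hv : 0 < ‖v‖ := hR.trans_lt (not_le.1 h)
    rw [norm_smul, Real.norm_of_nonneg (by positivity), div_mul_cancel₀ _ hv.ne']

/-- The projection onto the ball brings a point closer to every point of the ball. -/
theorem norm_projBall_sub_le {p : ℕ} {R : ℝ} {w : Vec p} (hw : ‖w‖ ≤ R) (v : Vec p) :
    ‖projBall R v - w‖ ≤ ‖v - w‖ := by
  have hR : 0 ≤ R := (norm_nonneg _).trans hw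
  unfold projBall
  split_ifs with h
  · exact le_rfl
  · have hv : 0 < ‖v‖ := hR.trans_lt (not_le.1 h)
    set s := R / ‖v‖ with hs
    have hs1 : s ≤ 1 := (div_le_one hv).2 (not_le.1 h).le
    have hsR : s * ‖v‖ = R := div_mul_cancel₀ _ hv.ne'
    have hin : inner ℝ v w ≤ s * ‖v‖ ^ 2 := by
      calc inner ℝ v w ≤ ‖v‖ * ‖w‖ := real_inner_le_norm _ _
        _ ≤ ‖v‖ * R := by gcongr
        _ = s * ‖v‖ ^ 2 := by rw [← hsR]; ring
    refine le_of_sq_le_sq ?_ (norm_nonneg _)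
    rw [norm_sub_sq_real, norm_sub_sq_real, inner_smul_left, norm_smul, conj_trivial,
      Real.norm_of_nonneg (by positivity)]
    have h1 : 0 ≤ (1 - s) * (‖v‖ ^ 2 * (1 + s) - 2 * inner ℝ v w) := by
      refine mul_nonneg (by linarith) ?_
      nlinarith [mul_nonneg (sub_nonneg.2 hs1) (sq_nonneg ‖v‖)]
    nlinarith

/-- The scaling matrix inverts the Stein approximation of the Hessian: the Sherman-Morrison
formula. -/
theorem act_scaling_stein {p n : ℕ} {φ : ℝ → ℝ} {r : Fin p} {X : Fin n → Vec p}
    {S : Finset (Fin n)} {b : Vec p} (hherm : (covEst r X S).IsHermitian)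
    (hinv : ∀ v, act (covEst r X S)⁻¹ (act (covEst r X S) v) = v)
    (ha : muHat φ 2 X b ≠ 0)
    (hD : muHat φ 2 X b + muHat φ 4 X b * inner ℝ (act (covEst r X S) b) b ≠ 0) (v : Vec p) :
    act (scaling φ r X S b) (act (muHat φ 2 X b • covEst r X S
      + muHat φ 4 X b • outer (act (covEst r X S) b)) v) = v := by
  set Z := covEst r X S
  set a := muHat φ 2 X b
  set d := muHat φ 4 X b
  have hsymm : inner ℝ b (act Z v) = inner ℝ (act Z b) v := by
    rw [real_inner_comm, inner_act_comm hherm]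
  set q := inner ℝ (act Z b) v
  set t := inner ℝ (act Z b) b with ht
  have hself : inner ℝ b (act Z b) = t := real_inner_comm _ _
  have hw : act (a • Z + d • outer (act Z b)) v = a • act Z v + (d * q) • act Z b := by
    rw [act_add, act_smul, act_smul, act_outer, smul_smul]
  have h1 : act Z⁻¹ (a • act Z v + (d * q) • act Z b) = a • v + (d * q) • b := by
    rw [act_add_right, act_smul_right, act_smul_right, hinv, hinv]
  have h2 : inner ℝ b (a • act Z v + (d * q) • act Z b) = q * (a + d * t) := by
    rw [inner_add_right, inner_smul_right, inner_smul_right, hsymm, hself]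
    ring
  have h3 : d / (a + d * t) * (q * (a + d * t)) = d * q := by
    rw [mul_comm q, ← mul_assoc, div_mul_cancel₀ _ hD]
  rw [hw, scaling, act_smul, act_sub, act_smul, act_outer, h1, h2, smul_smul, h3,
    add_sub_cancel_right, smul_smul, one_div_mul_cancel ha, one_smul]

theorem norm_act_scaling_le {p n : ℕ} {φ : ℝ → ℝ} {r : Fin p} {X : Fin n → Vec p}
    {S : Finset (Fin n)} {b : Vec p} {m σ ξ B₄ R : ℝ} (hm : 0 < m) (hξ : 0 < ξ)
    (hB : |muHat φ 4 X b| ≤ B₄) (hb : ‖b‖ ≤ R)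
    (hinv : ∀ w, ‖act (covEst r X S)⁻¹ w‖ ≤ 2 / σ ^ 2 * ‖w‖)
    (ha : m / 2 ≤ muHat φ 2 X b)
    (hD : ξ / 2 ≤ |muHat φ 2 X b + muHat φ 4 X b * inner ℝ (act (covEst r X S) b) b|)
    (w : Vec p) : ‖act (scaling φ r X S b) w‖ ≤ kappa m σ ξ B₄ R * ‖w‖ := by
  set Z := covEst r X S
  set a := muHat φ 2 X b
  set d := muHat φ 4 X b
  set D := a + d * inner ℝ (act Z b) b
  have hR : 0 ≤ R := (norm_nonneg _).trans hb
  have hB0 : 0 ≤ B₄ := (abs_nonneg _).trans hB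
  have ha0 : 0 < a := by linarith
  have hD0 : 0 < |D| := by linarith
  have h1 : |d / D| ≤ 2 * B₄ / ξ := by
    rw [abs_div, div_le_div_iff₀ hD0 hξ]
    nlinarith [abs_nonneg d]
  have h2 : ‖inner ℝ b w • b‖ ≤ R ^ 2 * ‖w‖ := by
    rw [norm_smul, Real.norm_eq_abs]
    calc |inner ℝ b w| * ‖b‖ ≤ (‖b‖ * ‖w‖) * ‖b‖ := by
          gcongr
          exact abs_real_inner_le_norm _ _
      _ ≤ (R * ‖w‖) * R := by gcongr
      _ = R ^ 2 * ‖w‖ := by ring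
  have h3 : ‖act Z⁻¹ w - (d / D) • inner ℝ b w • b‖
      ≤ (2 / σ ^ 2 + 2 * B₄ * R ^ 2 / ξ) * ‖w‖ := by
    refine (norm_sub_le _ _).trans ?_
    rw [norm_smul, Real.norm_eq_abs, add_mul]
    refine add_le_add (hinv w) ?_
    calc |d / D| * ‖inner ℝ b w • b‖ ≤ (2 * B₄ / ξ) * (R ^ 2 * ‖w‖) :=
          mul_le_mul h1 h2 (norm_nonneg _) (by positivity)
      _ = 2 * B₄ * R ^ 2 / ξ * ‖w‖ := by ring
  have h4 : 1 / a ≤ 2 / m := by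
    rw [div_le_div_iff₀ ha0 hm]
    linarith
  rw [scaling, act_smul, act_sub, act_smul, act_outer, norm_smul, kappa, mul_assoc,
    Real.norm_of_nonneg (by positivity)]
  exact mul_le_mul h4 h3 (norm_nonneg _) (by positivity)

/-- One step from `b`, when the scaling matrix is bounded by `κ` and inverts a symmetric matrix `A`
within `M` of the sample Hessian: the error contracts by `κ M`, up to a quadratic term. -/
theorem norm_step_sub_le {p n : ℕ} {φ : ℝ → ℝ} (hφ : ∀ k : ℕ, ContDiff ℝ k φ) {K L R κ M : ℝ}
    (hL : ∀ w, |iteratedDeriv 3 φ w| ≤ L) {X : Fin n → Vec p}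
    (hX : ∀ i, ‖X i‖ ≤ Real.sqrt K) {Y : Fin n → ℝ} {Q A : Mat p} (hA : A.IsHermitian)
    {b c : Vec p} (hc : ‖c‖ ≤ R) (hgrad : gradNegLogLik φ X Y c = 0) (hκ : 0 ≤ κ)
    (hQ : ∀ w, ‖act Q w‖ ≤ κ * ‖w‖) (hQA : ∀ v, act Q (act A v) = v)
    (hM : ∀ v : Vec p,
      |inner ℝ (act A v) v - inner ℝ (act (sampleHessian φ X b) v) v| ≤ M * ‖v‖ ^ 2) :
    ‖projBall R (b - act Q (gradNegLogLik φ X Y b)) - c‖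
      ≤ κ * M * ‖b - c‖ + L * Real.sqrt K ^ 3 * κ * ‖b - c‖ ^ 2 := by
  set H := sampleHessian φ X b
  set g := gradNegLogLik φ X Y b
  have hrem := norm_gradNegLogLik_sub_le hφ hL hX Y b c
  rw [hgrad, sub_zero] at hrem
  have hAH : ‖act (A - H) (b - c)‖ ≤ M * ‖b - c‖ := by
    refine norm_act_le_of_abs_inner_self_le (hA.sub (sampleHessian_isHermitian φ X b))
      (fun v => ?_) _
    rw [act_sub, inner_sub_left]
    exact hM v
  have heq : b - act Q g - c = act Q (act (A - H) (b - c) - (g - act H (b - c))) := by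
    have h1 : act (A - H) (b - c) - (g - act H (b - c)) = act A (b - c) - g := by
      rw [act_sub]
      abel
    have h2 : ∀ v w : Vec p, act Q (v - w) = act Q v - act Q w := fun v w => map_sub _ _ _
    rw [h1, h2, hQA]
    abel
  refine (norm_projBall_sub_le hc _).trans ?_
  rw [heq]
  calc ‖act Q (act (A - H) (b - c) - (g - act H (b - c)))‖
      ≤ κ * ‖act (A - H) (b - c) - (g - act H (b - c))‖ := hQ _
    _ ≤ κ * (M * ‖b - c‖ + L * Real.sqrt K ^ 3 * ‖b - c‖ ^ 2) := by
        gcongr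
        exact (norm_sub_le _ _).trans (add_le_add hAH hrem)
    _ = κ * M * ‖b - c‖ + L * Real.sqrt K ^ 3 * κ * ‖b - c‖ ^ 2 := by ring

/-! ### Typical samples -/

/-- The sample `X` with sub-sample `S` is typical at accuracy `e`: the empirical means of `φ''` and
`φ⁗`, the empirical Hessian and the sub-sampled covariance are within `e` of their population
counterparts, uniformly over the ball of radius `R`. -/
structure IsTypicalSample {p n : ℕ} (φ : ℝ → ℝ) (R e : ℝ) (law : Measure (Vec p)) (Sg : Mat p)
    (X : Fin n → Vec p) (S : Finset (Fin n)) : Prop where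
  mu_two : ∀ b : Vec p, ‖b‖ ≤ R → |muHat φ 2 X b - mu φ 2 law b| ≤ e
  mu_four : ∀ b : Vec p, ‖b‖ ≤ R → |muHat φ 4 X b - mu φ 4 law b| ≤ e
  hessian : ∀ b : Vec p, ‖b‖ ≤ R → ∀ v : Vec p, |inner ℝ (act (sampleHessian φ X b) v) v
    - ∫ x, inner ℝ v x ^ 2 * iteratedDeriv 2 φ (inner ℝ x b) ∂law| ≤ e * ‖v‖ ^ 2
  cov : ∀ v : Vec p, |inner ℝ (act (sampleCov X S) v) v - inner ℝ (act Sg v) v| ≤ e * ‖v‖ ^ 2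

/-- The error bound for one step at a typical sample. The operator inverted by the scaling matrix is
within `e` times a constant of the Stein approximation of the population Hessian, whose error is
`𝔇`. -/
theorem IsTypicalSample.norm_step_sub_le {p n : ℕ} {φ : ℝ → ℝ} (hφ : ∀ k : ℕ, ContDiff ℝ k φ)
    {K L R B₂ B₄ m σ ξ e : ℝ} (hK0 : 0 ≤ K) (hm : 0 < m) (hσ : 0 < σ) (hξ : 0 < ξ)
    (h₂ : ∀ w, |iteratedDeriv 2 φ w| ≤ B₂) (h₃ : ∀ w, |iteratedDeriv 3 φ w| ≤ L)
    (h₄ : ∀ w, |iteratedDeriv 4 φ w| ≤ B₄) {law : Measure (Vec p)} [IsProbabilityMeasure law]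
    {Sg : Mat p} {r : Fin p} (hK : ∀ᵐ v ∂law, ‖v‖ ≤ Real.sqrt K) (hSg : HasSecondMoment law Sg)
    (hs : IsSpiked (r : ℕ) σ Sg) (hmu : ∀ b : Vec p, ‖b‖ ≤ R → m ≤ mu φ 2 law b)
    {X : Fin n → Vec p} {S : Finset (Fin n)} (hX : ∀ i, ‖X i‖ ≤ Real.sqrt K)
    (htyp : IsTypicalSample φ R e law Sg X S) (he0 : 0 ≤ e) (he1 : e ≤ 1) (hem : e ≤ m / 2)
    (heσ : e ≤ σ ^ 2 / 2) (heξ : (1 + 3 * B₄ * R ^ 2 + K * R ^ 2) * e ≤ ξ / 2)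
    {Y : Fin n → ℝ} {b c : Vec p} (hb : ‖b‖ ≤ R)
    (hbξ : ξ < |mu φ 2 law b + mu φ 4 law b * inner ℝ (act Sg b) b|)
    (hc : IsOptimal φ X Y c) (hcR : ‖c‖ ≤ R) :
    ‖projBall R (b - act (scaling φ r X S b) (gradNegLogLik φ X Y b)) - c‖
      ≤ kappa m σ ξ B₄ R * (gaussDist φ R law Sg +
          (3 * B₂ + K + 3 * B₄ * R ^ 2 * (2 * K + 3) + K ^ 2 * R ^ 2 + 1) * e) * ‖b - c‖
        + L * Real.sqrt K ^ 3 * kappa m σ ξ B₄ R * ‖b - c‖ ^ 2 := by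
  have hR : 0 ≤ R := (norm_nonneg _).trans hb
  have hB₂ : 0 ≤ B₂ := (abs_nonneg _).trans (h₂ 0)
  have hB₄ : 0 ≤ B₄ := (abs_nonneg _).trans (h₄ 0)
  obtain ⟨hZherm, hZclose, hZlow⟩ := hs.threshold_near (sampleCov_isHermitian X S) he0 htyp.cov
  have hZdef : threshold r (sampleCov_isHermitian X S) = covEst r X S := rfl
  rw [hZdef] at hZherm hZclose hZlow
  set Z := covEst r X S
  set a := muHat φ 2 X b with ha
  set d := muHat φ 4 X b with hd
  have hσ2 : 0 < σ ^ 2 / 2 := by positivity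
  obtain ⟨hinv, hinvn⟩ := act_inv_of_coercive hσ2 fun v =>
    (mul_le_mul_of_nonneg_right (by linarith) (sq_nonneg ‖v‖)).trans (hZlow v)
  have hinvn' : ∀ w, ‖act Z⁻¹ w‖ ≤ 2 / σ ^ 2 * ‖w‖ := fun w => by
    have := hinvn w
    rwa [one_div_div] at this
  have ha2 := htyp.mu_two b hb
  have hd2 := htyp.mu_four b hb
  rw [← ha] at ha2
  rw [← hd] at hd2
  have haB : |a| ≤ B₂ := abs_muHat_le h₂ X b
  have hdB : |d| ≤ B₄ := abs_muHat_le h₄ X b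
  have ham : m / 2 ≤ a := by
    have := hmu b hb
    have := (abs_le.1 ha2).1
    linarith
  have hSgq := hSg.inner_act_self_le hK0 hK
  have hSgn : ∀ v, ‖act Sg v‖ ≤ K * ‖v‖ := norm_act_le_of_abs_inner_self_le hs.isHermitian hSgq
  have hZSg : ∀ v, ‖act (Z - Sg) v‖ ≤ 3 * e * ‖v‖ :=
    norm_act_le_of_abs_inner_self_le (hZherm.sub hs.isHermitian) fun v => by
      rw [act_sub, inner_sub_left]
      exact hZclose v
  have hb2 : ‖b‖ ^ 2 ≤ R ^ 2 := by gcongr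
  -- the denominator of the scaling matrix stays away from zero
  have hD : ξ / 2 ≤ |a + d * inner ℝ (act Z b) b| := by
    set μ₂ := mu φ 2 law b
    set μ₄ := mu φ 4 law b
    set t := inner ℝ (act Z b) b
    set t' := inner ℝ (act Sg b) b
    have e1 : |d * (t - t')| ≤ B₄ * (3 * e * R ^ 2) := by
      rw [abs_mul]
      exact mul_le_mul hdB ((hZclose b).trans (by gcongr)) (abs_nonneg _) hB₄
    have e2 : |(d - μ₄) * t'| ≤ e * (K * R ^ 2) := by
      rw [abs_mul]
      exact mul_le_mul hd2 ((hSgq b).trans (by gcongr)) (abs_nonneg _) he0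
    have e3 : μ₂ + μ₄ * t' = (a + d * t) + (-(a - μ₂) + -(d * (t - t')) + -((d - μ₄) * t')) := by
      ring
    have e4 : |μ₂ + μ₄ * t'| ≤ |a + d * t| + (e + B₄ * (3 * e * R ^ 2) + e * (K * R ^ 2)) := by
      rw [e3]
      refine (abs_add_le _ _).trans (add_le_add le_rfl ((abs_add_three _ _ _).trans ?_))
      rw [abs_neg, abs_neg, abs_neg]
      exact add_le_add (add_le_add ha2 e1) e2
    nlinarith
  have hκ : 0 ≤ kappa m σ ξ B₄ R := by
    unfold kappa
    positivity
  have hgrad := hc.gradNegLogLik_eq_zero ((hφ 1).differentiable (by norm_num))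
  have hD0 : a + d * inner ℝ (act Z b) b ≠ 0 := fun h0 => by
    rw [h0, abs_zero] at hD
    linarith
  have hA : (a • Z + d • outer (act Z b)).IsHermitian := by
    refine isHermitian_of_inner_act_comm fun v w => ?_
    simp only [act_add, act_smul, act_outer, inner_add_left, inner_smul_left, conj_trivial]
    rw [inner_act_comm hZherm v w]
    ring
  refine NewtonStein.norm_step_sub_le hφ h₃ hX hA hcR hgrad hκ
    (norm_act_scaling_le hm hξ hdB hb hinvn' ham hD)
    (act_scaling_stein hZherm hinv (by linarith : 0 < a).ne' hD0) fun v => ?_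
  have e1 := hZclose v
  have e2 := hSgq v
  have e3 := htyp.hessian b hb v
  have e4 := abs_stein_hessian_sub_le (Sg := Sg) hφ hK0 h₂ h₃ h₄ hK hs hb v
  have hγ' : |inner ℝ (act Sg b) v| ≤ K * R * ‖v‖ := by
    refine (abs_real_inner_le_norm _ _).trans ?_
    gcongr
    exact (hSgn b).trans (by gcongr)
  have hγγ : |inner ℝ (act Z b) v - inner ℝ (act Sg b) v| ≤ 3 * e * R * ‖v‖ := by
    rw [← inner_sub_left, ← act_sub]
    refine (abs_real_inner_le_norm _ _).trans ?_
    gcongr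
    exact (hZSg b).trans (by gcongr)
  simp only [act_add, act_smul, act_outer, inner_add_left, inner_smul_left, conj_trivial]
  set μ₂ := mu φ 2 law b
  set μ₄ := mu φ 4 law b
  set α := inner ℝ (act Z v) v
  set α' := inner ℝ (act Sg v) v
  set γ := inner ℝ (act Z b) v
  set γ' := inner ℝ (act Sg b) v
  set J := ∫ x, inner ℝ v x ^ 2 * iteratedDeriv 2 φ (inner ℝ x b) ∂law
  set η := inner ℝ (act (sampleHessian φ X b) v) v
  have f1 : |a * (α - α')| ≤ B₂ * (3 * e * ‖v‖ ^ 2) := by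
    rw [abs_mul]
    exact mul_le_mul haB e1 (abs_nonneg _) hB₂
  have f2 : |(a - μ₂) * α'| ≤ e * (K * ‖v‖ ^ 2) := by
    rw [abs_mul]
    exact mul_le_mul ha2 e2 (abs_nonneg _) he0
  have f3 : |d * ((γ - γ') * (γ + γ'))| ≤ B₄ * (3 * e * R * ‖v‖ * ((2 * K + 3) * R * ‖v‖)) := by
    have g1 : |γ + γ'| ≤ (2 * K + 3) * R * ‖v‖ := by
      have g2 : γ + γ' = (γ - γ') + 2 * γ' := by ring
      have g3 : 3 * e * R * ‖v‖ ≤ 3 * 1 * R * ‖v‖ := by gcongr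
      rw [g2]
      refine (abs_add_le _ _).trans ?_
      rw [abs_mul, abs_two]
      linarith
    rw [abs_mul, abs_mul]
    exact mul_le_mul hdB (mul_le_mul hγγ g1 (abs_nonneg _) (by positivity)) (by positivity) hB₄
  have f4 : |(d - μ₄) * γ' ^ 2| ≤ e * (K * R * ‖v‖) ^ 2 := by
    rw [abs_mul, abs_of_nonneg (sq_nonneg γ'), ← sq_abs γ']
    gcongr
  have hsplit : a * α + d * (γ * γ) - η
      = (μ₂ * α' + μ₄ * γ' ^ 2 - J) + (a * (α - α') + (a - μ₂) * α'
        + (d * ((γ - γ') * (γ + γ')) + (d - μ₄) * γ' ^ 2)) + -(η - J) := by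
    ring
  rw [hsplit]
  refine (abs_add_three _ _ _).trans ?_
  rw [abs_neg]
  have f5 := abs_add_three (a * (α - α')) ((a - μ₂) * α')
    (d * ((γ - γ') * (γ + γ')) + (d - μ₄) * γ' ^ 2)
  have f6 := abs_add_le (d * ((γ - γ') * (γ + γ'))) ((d - μ₄) * γ' ^ 2)
  calc _ ≤ gaussDist φ R law Sg * ‖v‖ ^ 2 + (B₂ * (3 * e * ‖v‖ ^ 2) + e * (K * ‖v‖ ^ 2)
        + (B₄ * (3 * e * R * ‖v‖ * ((2 * K + 3) * R * ‖v‖)) + e * (K * R * ‖v‖) ^ 2))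
        + e * ‖v‖ ^ 2 := add_le_add (add_le_add e4 (by linarith)) e3
    _ = _ := by ring

/-- The averaged function `x ↦ w(v, x) g(⟨x, b⟩)`, for parameters `(b, v)`, is bounded and Lipschitz
in the parameters when `w` and `g` are. -/
theorem abs_weighted_le {p : ℕ} {K B L Q : ℝ} {g : ℝ → ℝ} (hB : ∀ u, |g u| ≤ B)
    (hL : ∀ u u', |g u' - g u| ≤ L * |u' - u|) (hL0 : 0 ≤ L) {w : Vec p → Vec p → ℝ} (hQ : 0 ≤ Q)
    (hw : ∀ v x, ‖v‖ ≤ 1 → ‖x‖ ≤ Real.sqrt K → |w v x| ≤ Q)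
    (hw' : ∀ v v' x, ‖v‖ ≤ 1 → ‖v'‖ ≤ 1 → ‖x‖ ≤ Real.sqrt K →
      |w v x - w v' x| ≤ 2 * Q * dist v v')
    {x : Vec p} (hx : ‖x‖ ≤ Real.sqrt K) {θ θ' : Vec p × Vec p} (hθ : ‖θ.2‖ ≤ 1)
    (hθ' : ‖θ'.2‖ ≤ 1) :
    |w θ.2 x * g (inner ℝ x θ.1)| ≤ Q * B ∧
    |w θ.2 x * g (inner ℝ x θ.1) - w θ'.2 x * g (inner ℝ x θ'.1)|
      ≤ (Q * (L * Real.sqrt K) + 2 * Q * B) * dist θ θ' := by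
  have hB0 : 0 ≤ B := (abs_nonneg _).trans (hB 0)
  refine ⟨?_, ?_⟩
  · rw [abs_mul]
    exact mul_le_mul (hw _ _ hθ hx) (hB _) (abs_nonneg _) hQ
  · have h1 : |g (inner ℝ x θ.1) - g (inner ℝ x θ'.1)| ≤ L * Real.sqrt K * dist θ θ' := by
      refine (hL _ _).trans ?_
      rw [← inner_sub_right, mul_assoc]
      gcongr
      refine (abs_real_inner_le_norm _ _).trans ?_
      rw [← dist_eq_norm]
      gcongr
      exact le_max_left _ _
    have h2 : |w θ.2 x - w θ'.2 x| ≤ 2 * Q * dist θ θ' := by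
      refine (hw' _ _ _ hθ hθ' hx).trans ?_
      gcongr
      exact le_max_right _ _
    have h3 : w θ.2 x * g (inner ℝ x θ.1) - w θ'.2 x * g (inner ℝ x θ'.1)
        = w θ.2 x * (g (inner ℝ x θ.1) - g (inner ℝ x θ'.1))
          + (w θ.2 x - w θ'.2 x) * g (inner ℝ x θ'.1) := by ring
    rw [h3]
    refine (abs_add_le _ _).trans ?_
    rw [abs_mul, abs_mul]
    calc |w θ.2 x| * |g (inner ℝ x θ.1) - g (inner ℝ x θ'.1)|
          + |w θ.2 x - w θ'.2 x| * |g (inner ℝ x θ'.1)|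
        ≤ Q * (L * Real.sqrt K * dist θ θ') + 2 * Q * dist θ θ' * B :=
          add_le_add (mul_le_mul (hw _ _ hθ hx) h1 (abs_nonneg _) hQ)
            (mul_le_mul h2 (hB _) (abs_nonneg _) (by positivity))
      _ = _ := by ring

theorem muHat_eq_sampleAverage {p n : ℕ} (φ : ℝ → ℝ) (k : ℕ) (X : Fin n → Vec p) (b : Vec p) :
    muHat φ k X b
      = sampleAverage X Finset.univ fun x => 1 * iteratedDeriv k φ (inner ℝ x b) := by
  simp [muHat, sampleAverage]

theorem inner_act_sampleHessian_self {p n : ℕ} (φ : ℝ → ℝ) (X : Fin n → Vec p) (b v : Vec p) :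
    inner ℝ (act (sampleHessian φ X b) v) v
      = sampleAverage X Finset.univ
          fun x => inner ℝ v x ^ 2 * iteratedDeriv 2 φ (inner ℝ x b) := by
  rw [inner_act_sampleHessian]
  simp only [sampleAverage, Finset.card_univ, Fintype.card_fin]
  congr 1
  refine Finset.sum_congr rfl fun i _ => ?_
  rw [real_inner_comm v]
  ring

theorem inner_act_sampleCov_self {p n : ℕ} (X : Fin n → Vec p) (S : Finset (Fin n)) (v : Vec p) :
    inner ℝ (act (sampleCov X S) v) v = sampleAverage X S fun x => inner ℝ v x ^ 2 * 1 := by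
  simp only [sampleCov, act_smul, act_sum, act_outer, inner_smul_left, sum_inner, conj_trivial,
    sampleAverage, mul_one]
  congr 1
  refine Finset.sum_congr rfl fun i _ => ?_
  rw [real_inner_comm v]
  ring

/-- Some average over the index set `T` of a function `x ↦ w(v, x) g(⟨x, b⟩)`, with `b` in the ball
of radius `R` and `v` in the unit ball, is off its mean by more than `e`. -/
def HasDeviation {p n : ℕ} (R e : ℝ) (law : Measure (Vec p)) (X : Fin n → Vec p)
    (T : Finset (Fin n)) (g : ℝ → ℝ) (w : Vec p → Vec p → ℝ) : Prop :=
  ∃ b v : Vec p, ‖b‖ ≤ R ∧ ‖v‖ ≤ 1 ∧ e < |sampleAverage X T (fun x => w v x * g (inner ℝ x b))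
    - ∫ x, w v x * g (inner ℝ x b) ∂law|

theorem abs_sampleAverage_sub_le_of_not_hasDeviation {p n : ℕ} {R e : ℝ} {law : Measure (Vec p)}
    {X : Fin n → Vec p} {T : Finset (Fin n)} {g : ℝ → ℝ} {w : Vec p → Vec p → ℝ}
    (h : ¬ HasDeviation R e law X T g w) {b v : Vec p} (hb : ‖b‖ ≤ R) (hv : ‖v‖ ≤ 1) :
    |sampleAverage X T (fun x => w v x * g (inner ℝ x b))
      - ∫ x, w v x * g (inner ℝ x b) ∂law| ≤ e :=
  not_lt.1 fun hlt => h ⟨b, v, hb, hv, hlt⟩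

theorem isTypicalSample_of_not_hasDeviation {p n : ℕ} {φ : ℝ → ℝ} {K R e : ℝ} (hR : 0 ≤ R)
    {law : Measure (Vec p)} [IsProbabilityMeasure law] {Sg : Mat p}
    (hK : ∀ᵐ v ∂law, ‖v‖ ≤ Real.sqrt K) (hSg : HasSecondMoment law Sg)
    {X : Fin n → Vec p} {S : Finset (Fin n)}
    (n1 : ¬ HasDeviation R e law X Finset.univ (iteratedDeriv 2 φ) fun _ _ => 1)
    (n2 : ¬ HasDeviation R e law X Finset.univ (iteratedDeriv 4 φ) fun _ _ => 1)
    (n3 : ¬ HasDeviation R e law X Finset.univ (iteratedDeriv 2 φ) fun v x => inner ℝ v x ^ 2)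
    (n4 : ¬ HasDeviation R e law X S (fun _ => 1) fun v x => inner ℝ v x ^ 2) :
    IsTypicalSample φ R e law Sg X S := by
  have h0 : ‖(0 : Vec p)‖ ≤ 1 := by simp
  refine ⟨fun b hb => ?_, fun b hb => ?_, fun b hb v => ?_, fun v => ?_⟩
  · have := abs_sampleAverage_sub_le_of_not_hasDeviation n1 hb h0
    rw [← muHat_eq_sampleAverage] at this
    simp only [one_mul] at this
    exact this
  · have := abs_sampleAverage_sub_le_of_not_hasDeviation n2 hb h0
    rw [← muHat_eq_sampleAverage] at this
    simp only [one_mul] at this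
    exact this
  · refine abs_le_mul_norm_sq_of_unit (q := fun v => inner ℝ (act (sampleHessian φ X b) v) v
        - ∫ x, inner ℝ v x ^ 2 * iteratedDeriv 2 φ (inner ℝ x b) ∂law) ?_ ?_ v
    · intro c v
      simp only [act_smul_right, inner_smul_left, inner_smul_right, conj_trivial, mul_pow]
      simp only [mul_assoc]
      rw [integral_const_mul]
      ring
    · intro v hv
      rw [inner_act_sampleHessian_self]
      exact abs_sampleAverage_sub_le_of_not_hasDeviation n3 hb hv.le
  · refine abs_le_mul_norm_sq_of_unit (q := fun v =>
      inner ℝ (act (sampleCov X S) v) v - inner ℝ (act Sg v) v) ?_ ?_ v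
    · intro c v
      simp only [act_smul_right, inner_smul_left, inner_smul_right, conj_trivial]
      ring
    · intro v hv
      have := abs_sampleAverage_sub_le_of_not_hasDeviation n4 (b := 0)
        (by rw [norm_zero]; exact hR) hv.le
      rw [inner_act_sampleCov_self, hSg.inner_act_eq_integral hK]
      simpa only [mul_one, sq] using this

theorem abs_inner_sq_le_of_norm_le {p : ℕ} {K : ℝ} (hK0 : 0 ≤ K) {v x : Vec p} (hv : ‖v‖ ≤ 1)
    (hx : ‖x‖ ≤ Real.sqrt K) : |inner ℝ v x ^ 2| ≤ K := by
  rw [abs_of_nonneg (sq_nonneg _)]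
  have h1 : ‖v‖ ^ 2 ≤ 1 := pow_le_one₀ (norm_nonneg _) hv
  nlinarith [inner_sq_le_of_norm_le hK0 (v := v) hx]

theorem abs_inner_sq_sub_inner_sq_le {p : ℕ} {K : ℝ} (hK0 : 0 ≤ K) {v v' x : Vec p}
    (hv : ‖v‖ ≤ 1) (hv' : ‖v'‖ ≤ 1) (hx : ‖x‖ ≤ Real.sqrt K) :
    |inner ℝ v x ^ 2 - inner ℝ v' x ^ 2| ≤ 2 * K * dist v v' := by
  have h1 : |inner ℝ (v - v') x| ≤ dist v v' * Real.sqrt K := by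
    rw [dist_eq_norm]
    exact (abs_real_inner_le_norm _ _).trans (by gcongr)
  have h2 : |inner ℝ (v + v') x| ≤ 2 * Real.sqrt K := by
    refine (abs_real_inner_le_norm _ _).trans ?_
    have := norm_add_le v v'
    gcongr
    linarith
  have h3 : inner ℝ v x ^ 2 - inner ℝ v' x ^ 2 = inner ℝ (v - v') x * inner ℝ (v + v') x := by
    rw [inner_sub_left, inner_add_left]
    ring
  rw [h3, abs_mul]
  calc |inner ℝ (v - v') x| * |inner ℝ (v + v') x|
      ≤ (dist v v' * Real.sqrt K) * (2 * Real.sqrt K) :=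
        mul_le_mul h1 h2 (abs_nonneg _) (by positivity)
    _ = 2 * K * dist v v' := by
        have := Real.mul_self_sqrt hK0
        linear_combination (2 * dist v v') * this

/-- Samples are typical with high probability, beyond a sample size depending on the dimension and
the bounds only. -/
theorem exists_measure_not_isTypicalSample_le (p : ℕ) {K R B₂ B₃ B₄ B₅ e τ : ℝ} (hK0 : 0 ≤ K) (hR : 0 ≤ R)
    (hB₂ : 0 ≤ B₂) (hB₃ : 0 ≤ B₃) (hB₄ : 0 ≤ B₄) (hB₅ : 0 ≤ B₅) (he : 0 < e) (hτ : 0 < τ) :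
    ∃ N : ℕ, ∀ (φ : ℝ → ℝ), (∀ k : ℕ, ContDiff ℝ k φ) →
      (∀ w, |iteratedDeriv 2 φ w| ≤ B₂) → (∀ w, |iteratedDeriv 3 φ w| ≤ B₃) →
      (∀ w, |iteratedDeriv 4 φ w| ≤ B₄) → (∀ w, |iteratedDeriv 5 φ w| ≤ B₅) →
      ∀ (law : Measure (Vec p)) (Sg : Mat p) [IsProbabilityMeasure law],
      (∀ᵐ v ∂law, ‖v‖ ≤ Real.sqrt K) → HasSecondMoment law Sg →
      ∀ (Ω : Type*) [MeasurableSpace Ω] (P : Measure Ω) [IsProbabilityMeasure P] (n : ℕ)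
        (X : Fin n → Ω → Vec p) (S : Ω → Finset (Fin n)), (∀ i, Measurable (X i)) →
      (∀ i, P.map (X i) = law) → iIndepFun X P → Measurable S →
      IndepFun S (fun ω i => X i ω) P → N ≤ n → (∀ᵐ ω ∂P, N ≤ (S ω).card) →
      P {ω | ¬ IsTypicalSample φ R e law Sg (fun i => X i ω) (S ω)} ≤ ENNReal.ofReal τ := by
  set C : Set (Vec p × Vec p) := Metric.closedBall 0 R ×ˢ Metric.closedBall 0 1 with hC
  have hCt : TotallyBounded C :=
    ((isCompact_closedBall 0 R).prod (isCompact_closedBall 0 1)).totallyBounded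
  -- common bounds for the four classes of functions to be averaged
  set B := B₂ + B₄ + 1 with hB
  set L := B₃ + B₅ with hL
  set Q := K + 1 with hQ
  have hQ0 : 0 ≤ Q := by positivity
  have hB0 : 0 ≤ B := by positivity
  have hL0 : 0 ≤ L := by positivity
  obtain ⟨N, hN⟩ := exists_uniform_sampleAverage (E := Vec p) hCt (Q * B)
    (L := Q * (L * Real.sqrt K) + 2 * Q * B) (e := e) (τ := τ / 4) (by positivity) he (by positivity)
  refine ⟨N, fun φ hφ h₂ h₃ h₄ h₅ law Sg _ hK hSg Ω _ P _ n X S hX hlaw hind hSm hSX hn hS => ?_⟩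
  have key : ∀ (g : ℝ → ℝ) (w : Vec p → Vec p → ℝ), Continuous g → (∀ u, |g u| ≤ B) →
      (∀ u u', |g u' - g u| ≤ L * |u' - u|) → (∀ v, Continuous (w v)) →
      (∀ v x, ‖v‖ ≤ 1 → ‖x‖ ≤ Real.sqrt K → |w v x| ≤ Q) →
      (∀ v v' x, ‖v‖ ≤ 1 → ‖v'‖ ≤ 1 → ‖x‖ ≤ Real.sqrt K → |w v x - w v' x| ≤ 2 * Q * dist v v') →
      ∀ T : Ω → Finset (Fin n), Measurable T → IndepFun T (fun ω i => X i ω) P →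
      (∀ᵐ ω ∂P, N ≤ (T ω).card) →
      P {ω | HasDeviation R e law (fun i => X i ω) (T ω) g w} ≤ ENNReal.ofReal (τ / 4) := by
    intro g w hgc hgB hgL hwc hwQ hwL T hTm hTX hT
    have hC2 : ∀ θ ∈ C, ‖θ.2‖ ≤ 1 := fun θ hθ => by simpa [hC] using hθ.2
    have hmono : {ω | HasDeviation R e law (fun i => X i ω) (T ω) g w} ⊆
        {ω | ∃ θ ∈ C, e < |sampleAverage (fun i => X i ω) (T ω)
          (fun x => w θ.2 x * g (inner ℝ x θ.1)) - ∫ x, w θ.2 x * g (inner ℝ x θ.1) ∂law|} := by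
      rintro ω ⟨b, v, hb, hv, h⟩
      exact ⟨(b, v), by simpa [hC] using ⟨hb, hv⟩, h⟩
    refine (measure_mono hmono).trans ?_
    refine hN law (fun θ x => w θ.2 x * g (inner ℝ x θ.1)) (fun θ _ => ?_)
      (hK.mono fun x hx θ hθ => ?_) (hK.mono fun x hx θ hθ θ' hθ' => ?_) Ω P n X T hX hlaw hind hTm
      hTX hT
    · have := hwc θ.2
      exact Continuous.measurable (by fun_prop)
    · exact (abs_weighted_le hgB hgL hL0 hQ0 hwQ hwL hx (hC2 θ hθ) (hC2 θ hθ)).1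
    · exact (abs_weighted_le hgB hgL hL0 hQ0 hwQ hwL hx (hC2 θ hθ) (hC2 θ' hθ')).2
  have hcont : ∀ k : ℕ, Continuous (iteratedDeriv k φ) := fun k =>
    (hφ k).continuous_iteratedDeriv k le_rfl
  have h₂B : ∀ w, |iteratedDeriv 2 φ w| ≤ B := fun w => (h₂ w).trans (by linarith)
  have h₄B : ∀ w, |iteratedDeriv 4 φ w| ≤ B := fun w => (h₄ w).trans (by linarith)
  have h₂L := abs_sub_le_of_abs_deriv_le (hasDerivAt_iteratedDeriv hφ 2)
    (fun w => (h₃ w).trans (by linarith : B₃ ≤ L))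
  have h₄L := abs_sub_le_of_abs_deriv_le (hasDerivAt_iteratedDeriv hφ 4)
    (fun w => (h₅ w).trans (by linarith : B₅ ≤ L))
  have w1 : ∀ v x : Vec p, ‖v‖ ≤ 1 → ‖x‖ ≤ Real.sqrt K → |(1 : ℝ)| ≤ Q := fun _ _ _ _ => by
    rw [abs_one]
    linarith
  have w1' : ∀ v v' x : Vec p, ‖v‖ ≤ 1 → ‖v'‖ ≤ 1 → ‖x‖ ≤ Real.sqrt K →
      |(1 : ℝ) - 1| ≤ 2 * Q * dist v v' := fun _ _ _ _ _ _ => by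
    rw [sub_self, abs_zero]
    positivity
  have w2 : ∀ v x : Vec p, ‖v‖ ≤ 1 → ‖x‖ ≤ Real.sqrt K → |inner ℝ v x ^ 2| ≤ Q :=
    fun v x hv hx => (abs_inner_sq_le_of_norm_le hK0 hv hx).trans (by linarith)
  have w2' : ∀ v v' x : Vec p, ‖v‖ ≤ 1 → ‖v'‖ ≤ 1 → ‖x‖ ≤ Real.sqrt K →
      |inner ℝ v x ^ 2 - inner ℝ v' x ^ 2| ≤ 2 * Q * dist v v' := fun v v' x hv hv' hx =>
    (abs_inner_sq_sub_inner_sq_le hK0 hv hv' hx).trans (by gcongr; linarith)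
  have hUX : IndepFun (fun _ : Ω => (Finset.univ : Finset (Fin n))) (fun ω i => X i ω) P :=
    indepFun_const_left _ _
  have hU : ∀ᵐ ω ∂P, N ≤ ((fun _ : Ω => (Finset.univ : Finset (Fin n))) ω).card :=
    ae_of_all _ fun _ => by simpa using hn
  have k1 := key (iteratedDeriv 2 φ) (fun _ _ => 1) (hcont 2) h₂B h₂L (fun _ => continuous_const)
    w1 w1' _ measurable_const hUX hU
  have k2 := key (iteratedDeriv 4 φ) (fun _ _ => 1) (hcont 4) h₄B h₄L (fun _ => continuous_const)
    w1 w1' _ measurable_const hUX hU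
  have k3 := key (iteratedDeriv 2 φ) (fun v x => inner ℝ v x ^ 2) (hcont 2) h₂B h₂L
    (fun _ => by fun_prop) w2 w2' _ measurable_const hUX hU
  have k4 := key (fun _ => 1) (fun v x => inner ℝ v x ^ 2) continuous_const
    (fun _ => by rw [abs_one]; linarith)
    (fun _ _ => by rw [sub_self, abs_zero]; positivity)
    (fun _ => by fun_prop) w2 w2' S hSm hSX hS
  have hsub : {ω | ¬ IsTypicalSample φ R e law Sg (fun i => X i ω) (S ω)} ⊆
      {ω | HasDeviation R e law (fun i => X i ω) Finset.univ (iteratedDeriv 2 φ) fun _ _ => 1} ∪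
      {ω | HasDeviation R e law (fun i => X i ω) Finset.univ (iteratedDeriv 4 φ) fun _ _ => 1} ∪
      {ω | HasDeviation R e law (fun i => X i ω) Finset.univ (iteratedDeriv 2 φ)
        fun v x => inner ℝ v x ^ 2} ∪
      {ω | HasDeviation R e law (fun i => X i ω) (S ω) (fun _ => 1)
        fun v x => inner ℝ v x ^ 2} := by
    intro ω hω
    by_contra hnot
    simp only [Set.mem_union, not_or] at hnot
    exact hω (isTypicalSample_of_not_hasDeviation hR hK hSg hnot.1.1.1 hnot.1.1.2 hnot.1.2 hnot.2)
  have hτ4 : ENNReal.ofReal τ = ENNReal.ofReal (τ / 4) + ENNReal.ofReal (τ / 4)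
      + ENNReal.ofReal (τ / 4) + ENNReal.ofReal (τ / 4) := by
    have h4 : 0 ≤ τ / 4 := by positivity
    rw [← ENNReal.ofReal_add h4 h4, ← ENNReal.ofReal_add (by positivity) h4,
      ← ENNReal.ofReal_add (by positivity) h4]
    congr 1
    ring
  rw [hτ4]
  refine (measure_mono hsub).trans ((measure_union_le _ _).trans (add_le_add ?_ k4))
  refine (measure_union_le _ _).trans (add_le_add ?_ k3)
  exact (measure_union_le _ _).trans (add_le_add k1 k2)

/-! ### The error recursion in expectation -/

/-- Integration of a pointwise recursion that holds off an exceptional set, on which the crude bound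
`ρ` is used. Neither `f'` nor the exceptional set needs to be measurable. -/
theorem integral_le_of_recursion {Ω : Type*} [MeasurableSpace Ω] {P : Measure Ω}
    [IsProbabilityMeasure P] {f f' : Ω → ℝ} {bad : Set Ω} {A C ρ q : ℝ} (hA : 0 ≤ A) (hC : 0 ≤ C)
    (hρ : 0 ≤ ρ) (hf : Integrable f P) (hf0 : ∀ ω, 0 ≤ f ω) (hfρ : ∀ᵐ ω ∂P, f ω ≤ ρ)
    (hf'0 : ∀ ω, 0 ≤ f' ω) (hf'ρ : ∀ᵐ ω ∂P, f' ω ≤ ρ) (hbad : P.real bad ≤ q)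
    (hrec : ∀ᵐ ω ∂P, ω ∉ bad → f' ω ≤ A * f ω + C * f ω ^ 2) :
    ∫ ω, f' ω ∂P ≤ A * ∫ ω, f ω ∂P + C * ∫ ω, f ω ^ 2 ∂P + ρ * q := by
  have hf2 : Integrable (fun ω => f ω ^ 2) P := by
    refine (hf.const_mul ρ).mono' (hf.1.pow 2) (hfρ.mono fun ω h => ?_)
    rw [Real.norm_of_nonneg (sq_nonneg _), sq]
    exact mul_le_mul_of_nonneg_right h (hf0 ω)
  set M := toMeasurable P bad
  have hMm : MeasurableSet M := measurableSet_toMeasurable P bad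
  have hMq : P.real M ≤ q := by
    rwa [measureReal_def, measure_toMeasurable, ← measureReal_def]
  have hi1 := hf.const_mul A
  have hi2 := hf2.const_mul C
  have hi3 : Integrable (M.indicator fun _ => ρ) P := (integrable_const ρ).indicator hMm
  have hi12 : Integrable (fun ω => A * f ω + C * f ω ^ 2) P := hi1.add hi2
  have hle : f' ≤ᵐ[P] fun ω => (A * f ω + C * f ω ^ 2) + M.indicator (fun _ => ρ) ω := by
    filter_upwards [hf'ρ, hrec] with ω h1 h2
    have h0 : 0 ≤ A * f ω + C * f ω ^ 2 :=
      add_nonneg (mul_nonneg hA (hf0 ω)) (mul_nonneg hC (sq_nonneg _))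
    by_cases hω : ω ∈ M
    · rw [Set.indicator_of_mem hω]
      linarith
    · rw [Set.indicator_of_notMem hω, add_zero]
      exact h2 fun h => hω (subset_toMeasurable P bad h)
  refine (integral_mono_of_nonneg (ae_of_all _ hf'0) (hi12.add hi3) hle).trans ?_
  simp only [Pi.add_apply]
  rw [integral_add hi12 hi3, integral_add hi1 hi2, integral_const_mul, integral_const_mul,
    integral_indicator_const _ hMm, smul_eq_mul]
  nlinarith

theorem ae_card_eq_of_map_eq_uniformOn {Ω : Type*} [MeasurableSpace Ω] {P : Measure Ω} {n s : ℕ}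
    {S : Ω → Finset (Fin n)} (hS : Measurable S)
    (h : P.map S = uniformOn {T : Finset (Fin n) | T.card = s}) : ∀ᵐ ω ∂P, (S ω).card = s := by
  have h1 : ∀ᵐ T ∂P.map S, T.card = s := by
    rw [h, uniformOn]
    exact ae_cond_mem trivial
  exact ae_of_ae_map hS.aemeasurable h1

theorem norm_iterate_le {p n : ℕ} {φ : ℝ → ℝ} {R : ℝ} (hR : 0 ≤ R) {r : Fin p} {X : Fin n → Vec p}
    {Y : Fin n → ℝ} {S : Finset (Fin n)} {b₀ : Vec p} {t : ℕ} (ht : 0 < t) :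
    ‖iterate φ R r X Y S b₀ t‖ ≤ R := by
  obtain ⟨k, rfl⟩ := Nat.exists_eq_succ_of_ne_zero ht.ne'
  exact norm_projBall_le hR _

theorem kappa_pos {m σ ξ B₄ R : ℝ} (hm : 0 < m) (hσ : 0 < σ) (hξ : 0 < ξ) (hB₄ : 0 ≤ B₄) :
    0 < kappa m σ ξ B₄ R := by
  unfold kappa
  positivity

/-- An accuracy that meets all requirements of the argument. -/
theorem exists_pos_le_of_pos {a₁ a₂ a₃ a₄ c₄ a₅ c₅ : ℝ} (h₁ : 0 < a₁) (h₂ : 0 < a₂) (h₃ : 0 < a₃)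
    (h₄ : 0 < a₄) (hc₄ : 0 < c₄) (h₅ : 0 < a₅) (hc₅ : 0 < c₅) :
    ∃ e : ℝ, 0 < e ∧ e ≤ a₁ ∧ e ≤ a₂ ∧ e ≤ a₃ ∧ c₄ * e ≤ a₄ ∧ c₅ * e ≤ a₅ := by
  refine ⟨min a₁ (min a₂ (min a₃ (min (a₄ / c₄) (a₅ / c₅)))), by positivity, ?_, ?_, ?_, ?_, ?_⟩
  · simp
  · simp
  · simp
  · rw [mul_comm, ← le_div_iff₀ hc₄]
    simp
  · rw [mul_comm, ← le_div_iff₀ hc₅]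
    simp

end NewtonStein

open NewtonStein in
theorem mainTheorem4 (K R B₂ B₄ : ℝ) (hK : 0 < K) (hR : 0 < R) (hB₂ : 0 < B₂) (hB₄ : 0 < B₄) :
    ∃ c c₁ c₂ : ℝ, 0 < c ∧ 0 < c₁ ∧ 0 < c₂ ∧
    ∀ B₃ B₅ m σ ξ : ℝ, 0 < B₃ → 0 < B₅ → 0 < m → 0 < σ → 0 < ξ →
    ∃ N₀ : ℕ,
    ∀ (p n s : ℕ), 2 ≤ p → N₀ ≤ n → N₀ ≤ s →
    -- the generalized linear model
    ∀ (φ : ℝ → ℝ), IsCumulantGeneratingFunction φ →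
      (∀ w, |iteratedDeriv 2 φ w| ≤ B₂) → (∀ w, |iteratedDeriv 3 φ w| ≤ B₃) →
      (∀ w, |iteratedDeriv 4 φ w| ≤ B₄) → (∀ w, |iteratedDeriv 5 φ w| ≤ B₅) →
    -- the common law of the covariates
    ∀ (law : Measure (Vec p)) (Sg : Mat p) (r : Fin p),
      IsProbabilityMeasure law →
      (∀ᵐ v ∂law, ‖v‖ ≤ Real.sqrt K) → ∫ v, v ∂law = 0 → HasSecondMoment law Sg →
      IsSpiked (r : ℕ) σ Sg →
      (∀ b : Vec p, ‖b‖ ≤ R → m ≤ mu φ 2 law b) →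
    -- the data, the sub-sample, the initial point and the optimal value
    ∀ (Ω : Type*) [MeasurableSpace Ω] (P : Measure Ω) [IsProbabilityMeasure P]
      (X : Fin n → Ω → Vec p) (Y : Fin n → Ω → ℝ) (S : Ω → Finset (Fin n)) (b₀ bs : Ω → Vec p),
      (∀ i, Measurable (X i)) → (∀ i, Measurable (Y i)) → Measurable S → Measurable b₀ → Measurable bs →
      (∀ i, P.map (X i) = law) → iIndepFun X P →
      P.map S = uniformOn {T : Finset (Fin n) | T.card = s} →
      IndepFun S (fun ω i => (X i ω, Y i ω)) P →
      (∀ᵐ ω ∂P, ‖bs ω‖ ≤ R) →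
      (∀ᵐ ω ∂P, (∃ b, IsOptimal φ (fun i => X i ω) (fun i => Y i ω) b ∧ ‖b‖ ≤ R) →
        IsOptimal φ (fun i => X i ω) (fun i => Y i ω) (bs ω)) →
    -- the iterates
    ∀ (bt : ℕ → Ω → Vec p),
      (∀ t ω, bt t ω = iterate φ R r (fun i => X i ω) (fun i => Y i ω) (S ω) (b₀ ω) t) →
    ∀ (t : ℕ), 0 < t →
    ∀ (δ ε : ℝ), P.real (goodEvent φ R ξ law Sg X Y (bt t) bs)ᶜ ≤ δ →
      20 * R * (c / (p : ℝ) ^ 2 + δ) ≤ ε →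
      ε < ∫ ω, ‖bt t ω - bs ω‖ ∂P →
      ∫ ω, ‖bt (t + 1) ω - bs ω‖ ∂P ≤
        (tau₁ (kappa m σ ξ B₄ R) c₁ (gaussDist φ R law Sg) p n s + 0.1) * ∫ ω, ‖bt t ω - bs ω‖ ∂P +
          tau₂ (kappa m σ ξ B₄ R) c₂ * ∫ ω, ‖bt t ω - bs ω‖ ^ 2 ∂P := by
  -- `2 B₂ + B₄` bounds the third derivative of `φ`, by interpolation
  refine ⟨1, 1, (2 * B₂ + B₄) * Real.sqrt K ^ 3, one_pos, one_pos, by positivity,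
    fun B₃ B₅ m σ ξ hB₃ hB₅ hm hσ hξ => ?_⟩
  set κ := kappa m σ ξ B₄ R with hκ
  have hκ0 : 0 < κ := kappa_pos hm hσ hξ hB₄.le
  -- `d` bounds the dimension of every admissible law
  obtain ⟨d, hd⟩ := exists_nat_gt (K / σ ^ 2)
  have hd0 : (0 : ℝ) < d := lt_of_le_of_lt (by positivity) hd
  set Ce := 3 * B₂ + K + 3 * B₄ * R ^ 2 * (2 * K + 3) + K ^ 2 * R ^ 2 + 1 with hCe
  have hCe0 : 0 < Ce := by positivity
  obtain ⟨e, he0, he1, hem, heσ, heξ, heκ⟩ := exists_pos_le_of_pos one_pos (half_pos hm)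
    (by positivity : 0 < σ ^ 2 / 2) (half_pos hξ)
    (by positivity : 0 < 1 + 3 * B₄ * R ^ 2 + K * R ^ 2)
    (by positivity : 0 < 1 / (2 * (d : ℝ) ^ 2)) (mul_pos hκ0 hCe0)
  choose N hN using fun p : ℕ => exists_measure_not_isTypicalSample_le p (K := K) (R := R)
    (B₂ := B₂) (B₃ := B₃) (B₄ := B₄) (B₅ := B₅) (e := e) (τ := 1 / (2 * (d : ℝ) ^ 2)) hK.le hR.le
    hB₂.le hB₃.le hB₄.le hB₅.le he0 (by positivity)
  refine ⟨(Finset.range (d + 1)).sup N, ?_⟩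
  intro p n s hp hn hs φ hφ h₂ h₃ h₄ h₅ law Sg r hlawP hlawK _ hSg hspike hmu Ω _ P _ X Y S b₀ bs hX
    _ hS _ _ hlaw hind hSu hSX hbs _ bt hbt t ht δ ε hδ hε hεlt
  have hφc : ∀ k : ℕ, ContDiff ℝ k φ := hφ.contDiff
  have hp0 : (0 : ℝ) < p := by exact_mod_cast (by omega : 0 < p)
  have hpd : (p : ℝ) ≤ d := by
    have := hSg.card_mul_sq_le hK.le hlawK hspike
    rw [← le_div_iff₀ (by positivity)] at this
    exact this.trans hd.le
  have hNp : N p ≤ (Finset.range (d + 1)).sup N :=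
    Finset.le_sup (Finset.mem_range.2 (Nat.lt_succ_of_le (by exact_mod_cast hpd)))
  have hcard := ae_card_eq_of_map_eq_uniformOn hS hSu
  have hSX' : IndepFun S (fun ω i => X i ω) P :=
    hSX.comp (φ := id) (ψ := fun (z : Fin n → Vec p × ℝ) i => (z i).1) measurable_id
      (measurable_pi_lambda _ fun i => (measurable_pi_apply i).fst)
  have htyp := hN p φ hφc h₂ h₃ h₄ h₅ law Sg hlawK hSg Ω P n X S hX hlaw hind hS hSX'
    (hNp.trans hn) (hcard.mono fun ω h => by rw [h]; exact hNp.trans hs)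
  have hXK : ∀ᵐ ω ∂P, ∀ i, ‖X i ω‖ ≤ Real.sqrt K := ae_all_iff.2 fun i => by
    rw [← hlaw i] at hlawK
    exact ae_of_ae_map (hX i).aemeasurable hlawK
  have hbtR : ∀ k, 0 < k → ∀ ω, ‖bt k ω‖ ≤ R := fun k hk ω => by
    rw [hbt]
    exact norm_iterate_le hR.le hk
  have hdiam : ∀ k, 0 < k → ∀ᵐ ω ∂P, ‖bt k ω - bs ω‖ ≤ 2 * R := fun k hk =>
    hbs.mono fun ω h => (norm_sub_le _ _).trans (by linarith [hbtR k hk ω])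
  have hδ0 : 0 ≤ δ := measureReal_nonneg.trans hδ
  have hε0 : 0 ≤ ε := le_trans (by positivity) hε
  have hint : Integrable (fun ω => ‖bt t ω - bs ω‖) P := by
    by_contra h
    rw [integral_undef h] at hεlt
    exact absurd hεlt (not_lt.2 hε0)
  set bad := (goodEvent φ R ξ law Sg X Y (bt t) bs)ᶜ ∪
    {ω | ¬ IsTypicalSample φ R e law Sg (fun i => X i ω) (S ω)} with hbad
  have hbadP : P.real bad ≤ δ + 1 / (2 * (d : ℝ) ^ 2) :=
    (measureReal_union_le _ _).trans
      (add_le_add hδ (ENNReal.toReal_le_of_le_ofReal (by positivity) htyp))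
  set D := gaussDist φ R law Sg with hD
  have hD0 : 0 ≤ D := gaussDist_nonneg φ R law Sg
  have h₃' := abs_deriv_le_of_abs_le (hasDerivAt_iteratedDeriv hφc 2)
    (hasDerivAt_iteratedDeriv hφc 3) h₂ h₄
  have hrec : ∀ᵐ ω ∂P, ω ∉ bad → ‖bt (t + 1) ω - bs ω‖ ≤ κ * (D + Ce * e) * ‖bt t ω - bs ω‖
      + (2 * B₂ + B₄) * Real.sqrt K ^ 3 * κ * ‖bt t ω - bs ω‖ ^ 2 := by
    filter_upwards [hXK] with ω hω hgood
    simp only [hbad, Set.mem_union, not_or, Set.mem_compl_iff, not_not] at hgood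
    obtain ⟨⟨hgξ, hgopt, hgR⟩, hgtyp⟩ := hgood
    have hnext : bt (t + 1) ω = projBall R (bt t ω - act (scaling φ r (fun i => X i ω) (S ω) (bt t ω))
        (gradNegLogLik φ (fun i => X i ω) (fun i => Y i ω) (bt t ω))) := by
      rw [hbt (t + 1), hbt t, iterate]
    rw [hnext]
    exact IsTypicalSample.norm_step_sub_le hφc hK.le hm hσ hξ h₂ h₃' h₄ hlawK hSg hspike hmu hω
      (not_not.1 hgtyp) he0.le he1 hem heσ heξ (hbtR t ht ω) hgξ hgopt hgR
  have hmain := integral_le_of_recursion (by positivity) (by positivity) (by positivity) hint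
    (fun ω => norm_nonneg _) (hdiam t ht) (fun ω => norm_nonneg _) (hdiam (t + 1) t.succ_pos)
    hbadP hrec
  set I := ∫ ω, ‖bt t ω - bs ω‖ ∂P with hI
  have hI0 : 0 ≤ I := integral_nonneg fun ω => norm_nonneg _
  have hI2 : I ≤ 2 * R := by
    have := integral_mono_ae hint (integrable_const (2 * R)) (hdiam t ht)
    simpa using this
  have hsqrt := Real.sqrt_nonneg
    ((p : ℝ) / min ((p : ℝ) / Real.log p * s) ((n : ℝ) / Real.log n))
  -- the concentration errors and the exceptional set cost at most `ε / 10`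
  have hslack : κ * Ce * e * I + 2 * R * (δ + 1 / (2 * (d : ℝ) ^ 2)) ≤ 0.1 * I := by
    have h1 : κ * Ce * e * I ≤ 1 / (2 * (d : ℝ) ^ 2) * (2 * R) :=
      mul_le_mul heκ hI2 hI0 (by positivity)
    have h2 : 1 / (d : ℝ) ^ 2 ≤ 1 / (p : ℝ) ^ 2 := by gcongr
    have h3 : 1 / (2 * (d : ℝ) ^ 2) = 1 / (d : ℝ) ^ 2 / 2 := by
      rw [div_div, mul_comm]
    rw [h3] at h1 ⊢
    nlinarith
  have htau : κ * D ≤ tau₁ κ 1 D p n s := by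
    unfold tau₁
    have : 0 ≤ 1 * κ * Real.sqrt
        ((p : ℝ) / min ((p : ℝ) / Real.log p * s) ((n : ℝ) / Real.log n)) := by positivity
    linarith
  have htauI := mul_le_mul_of_nonneg_right htau hI0
  rw [tau₂]
  linarith
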